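/- Let $(M,J,g)$ be a Hermitian surface (a complex manifold of complex dimension $2$ with a smooth Riemannian metric $g$ such that $g(J\cdot,J\cdot)=g$), let $(\Sigma,\mathtt{j})$ be a compact connected Riemann surface, and let $f:\Sigma\to M$ be a smooth conformal immersion; give $\Sigma$ the induced metric $f^*g$, so that $f$ is isometric. Let $\nabla$ be the Chern connection of $M$, i.e. the unique connection on $TM$ with $\nabla J=0$, $\nabla g=0$ whose torsion has vanishing $(1,1)$-part. Let $\nabla df$ be the second fundamental form of $f$, $(\nabla df)(X,Y)=\nabla_X(df(Y))-df(D_XY)$ with $D$ the Levi-Civita connection of $f^*g$, and assume that $f$ is Chern minimal, that is, $\operatorname{tr}_{f^*g}\nabla df=0$. A point $x\in\Sigma$ is called complex if $df\circ\mathtt{j}=J\circ df$ at $x$, anticomplex if $df\circ\mathtt{j}=-J\circ df$ at $x$, and real otherwise; $f$ is real if all points of $\Sigma$ are real. Assume that $f$ is generic, i.e. neither holomorphic (all points complex) nor antiholomorphic (all points anticomplex). The Kähler angle $\alpha:\Sigma\to[0,\pi]$ is defined by $\cos\alpha=g(J\,df(e),df(\mathtt{j}e))$ for a unit tangent vector $e$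 of $\Sigma$. Let $K$ be the Gaussian curvature of $f^*g$, and let $K^\perp$ be the normal curvature, i.e. the curvature of the connection induced on the normal bundle by the Levi-Civita connection of $(M,g)$: $K^\perp=g(R^\perp(e_1,e_2)e_4,e_3)$, where $(e_1,e_2)$ and $(e_3,e_4)$ are orthonormal bases of the tangent and the normal plane, $(e_1,e_2)$ is positively oriented for $\mathtt{j}$, and $(e_1,e_2,e_3,e_4)$ is positively oriented for the complex orientation of $M$. Then $f$ is real with constant Kähler angle if and only if $K+K^\perp=0$ everywhere on $\Sigma$. -/

import Mathlib

open Set Filter Topology Bundle Manifold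
open scoped ContDiff

noncomputable section

namespace ChernSurface

/-! ### Complex manifolds as real smooth manifolds -/

/-- The real smooth manifold underlying a complex manifold (same charts). -/
instance realSmooth {E : Type*} [NormedAddCommGroup E] [NormedSpace ℂ E] {M : Type*}
    [TopologicalSpace M] [ChartedSpace E M] [h : IsManifold 𝓘(ℂ, E) ω M] :
    IsManifold 𝓘(ℝ, E) ∞ M := by
  refine isManifold_of_contDiffOn 𝓘(ℝ, E) ∞ M fun e e' he he' => ?_
  have h1 := (contDiffGroupoid ω 𝓘(ℂ, E)).compatible he he'
  have h2 := (contDiffGroupoid_le (I := 𝓘(ℂ, E)) (m := ∞) (n := ω) le_top h1)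
  have h3 := (mem_groupoid_of_pregroupoid.mp h2).1
  simp only [contDiffPregroupoid] at h3
  exact h3.restrict_scalars ℝ

/-- Multiplication by `i` as a real linear map. -/
def mulI (E : Type*) [NormedAddCommGroup E] [NormedSpace ℂ E] : E →L[ℝ] E :=
  ((Complex.I : ℂ) • ContinuousLinearMap.id ℂ E).restrictScalars ℝ

/-- The complex structure on the tangent space of a complex manifold: multiplication by `i` in
holomorphic coordinates. It is the `J` of `M`, and the `j` of a Riemann surface (`E = ℂ`). -/
def complexStructure (E : Type*) [NormedAddCommGroup E] [NormedSpace ℂ E] {M : Type*}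
    [TopologicalSpace M] [ChartedSpace E M] (p : M) :
    TangentSpace 𝓘(ℝ, E) p →L[ℝ] TangentSpace 𝓘(ℝ, E) p :=
  mulI E

/-- A Hermitian metric on a complex manifold `M`: a smooth Riemannian metric that is invariant
under the complex structure. -/
structure HermitianMetric (E : Type*) [NormedAddCommGroup E] [NormedSpace ℂ E] (M : Type*)
    [TopologicalSpace M] [ChartedSpace E M] [IsManifold 𝓘(ℂ, E) ω M] extends
    ContMDiffRiemannianMetric 𝓘(ℝ, E) ∞ E (fun p : M => TangentSpace 𝓘(ℝ, E) p) where
  inner_complexStructure : ∀ (p : M) (v w : TangentSpace 𝓘(ℝ, E) p),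
    inner p (complexStructure E p v) (complexStructure E p w) = inner p v w

/-! ### Connections in coordinates

In this section `G` is the matrix of a metric in a coordinate system with values in `E`. -/

section Coordinates

variable {V : Type*} [NormedAddCommGroup V] [NormedSpace ℝ V]
variable {E : Type*} [NormedAddCommGroup E] [NormedSpace ℂ E]

/-- Levi-Civita connection: `D_u v = ∂_u v + Γ(u, v)` where the Christoffel form `Γ` is given by
`2 G(Γ(u, v), w) = ∂_u G(v, w) + ∂_v G(u, w) - ∂_w G(u, v)`. -/
def leviCivita (G : V → V →L[ℝ] V →L[ℝ] ℝ) (y u v : V) : V :=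
  (G y).inverse
    ((1 / 2 : ℝ) • (fderiv ℝ G y u v + fderiv ℝ G y v u - ((fderiv ℝ G y).flip u).flip v))

/-- Chern connection of a Hermitian metric in holomorphic coordinates: `∇_u v = ∂_u v + Γ(u, v)`
with `2 G(Γ(u, v), w) = ∂_u G(v, w) + ∂_{iu} G(v, iw)`, that is `Γ = (∂h) h⁻¹` for the Hermitian
matrix `h(v, w) = G(v, w) + i G(v, iw)`. See `isChernForm_iff`. -/
def chernForm (G : E → E →L[ℝ] E →L[ℝ] ℝ) (y u v : E) : E :=
  (G y).inverse
    ((1 / 2 : ℝ) • (fderiv ℝ G y u v + (fderiv ℝ G y (mulI E u) v).comp (mulI E)))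

/-- The connection `∇_u v = ∂_u v + Γ(u, v)` satisfies at the point `y` the conditions
characterizing the Chern connection: `∇J = 0`, `∇G = 0`, and the torsion `T` has no `(1,1)`-part,
i.e. `T(iu, v) = T(u, iv)`. -/
structure IsChernForm (G : E → E →L[ℝ] E →L[ℝ] ℝ) (y : E) (Γ : E →ₗ[ℝ] E →ₗ[ℝ] E) : Prop where
  parallel_J : ∀ u v, Γ u (mulI E v) = mulI E (Γ u v)
  parallel_metric : ∀ u v w, fderiv ℝ G y u v w = G y (Γ u v) w + G y v (Γ u w)
  torsion : ∀ u v, Γ (mulI E u) v - Γ v (mulI E u) = Γ u (mulI E v) - Γ (mulI E v) u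

/-- Riemann curvature `R(u, v) w` of the Levi-Civita connection of `G`. -/
def riemannCurvature (G : V → V →L[ℝ] V →L[ℝ] ℝ) (y u v w : V) : V :=
  fderiv ℝ (fun y' => leviCivita G y' v w) y u - fderiv ℝ (fun y' => leviCivita G y' u w) y v
    + leviCivita G y u (leviCivita G y v w) - leviCivita G y v (leviCivita G y u w)

/-- Sectional curvature of the plane spanned by `u` and `v`. -/
def sectionalCurvature (G : V → V →L[ℝ] V →L[ℝ] ℝ) (y u v : V) : ℝ :=
  G y (riemannCurvature G y u v v) u / (G y u u * G y v v - G y u v ^ 2)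

/-- Orthogonal projection onto the normal plane of the conformal immersed surface `F` at `F z`;
by conformality `dF(1)` and `dF(i)` are an orthogonal basis of the tangent plane. -/
def normalProj (G : E → E →L[ℝ] E →L[ℝ] ℝ) (F : ℂ → E) (z : ℂ) (w : E) : E :=
  w - (G (F z) w (fderiv ℝ F z 1) / G (F z) (fderiv ℝ F z 1) (fderiv ℝ F z 1)) • fderiv ℝ F z 1
    - (G (F z) w (fderiv ℝ F z Complex.I) /
        G (F z) (fderiv ℝ F z Complex.I) (fderiv ℝ F z Complex.I)) • fderiv ℝ F z Complex.I

/-- Normal connection `(D_u W)^⊥` of the surface `F`, for a field `W` along `F`. -/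
def normalDeriv (G : E → E →L[ℝ] E →L[ℝ] ℝ) (F : ℂ → E) (u : ℂ) (W : ℂ → E) (z : ℂ) : E :=
  normalProj G F z (fderiv ℝ W z u + leviCivita G (F z) (fderiv ℝ F z u) (W z))

/-- Curvature `R^⊥(∂x, ∂y) n` of the normal connection; the normal vector `n` is extended to
the normal field `z' ↦ n^⊥` (the result does not depend on the extension). -/
def normalBundleCurvature (G : E → E →L[ℝ] E →L[ℝ] ℝ) (F : ℂ → E) (z : ℂ) (n : E) : E :=
  normalDeriv G F 1 (normalDeriv G F Complex.I fun z' => normalProj G F z' n) z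
    - normalDeriv G F Complex.I (normalDeriv G F 1 fun z' => normalProj G F z' n) z

/-- `(n₁, n₂)` is an orthonormal basis of the orthogonal complement of the plane spanned by
`a, b`, and `(a, b, n₁, n₂)` is positively oriented for the complex orientation of `E`, given by
`ω ∧ ω` where `ω(v, w) = B(iv, w)`. -/
structure IsOrientedNormalFrame (B : E →L[ℝ] E →L[ℝ] ℝ) (a b n₁ n₂ : E) : Prop where
  unit₁ : B n₁ n₁ = 1
  unit₂ : B n₂ n₂ = 1
  orth : B n₁ n₂ = 0
  normal₁ : B n₁ a = 0 ∧ B n₁ b = 0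
  normal₂ : B n₂ a = 0 ∧ B n₂ b = 0
  oriented : 0 < B (mulI E a) b * B (mulI E n₁) n₂ - B (mulI E a) n₁ * B (mulI E b) n₂
    + B (mulI E a) n₂ * B (mulI E b) n₁

end Coordinates

/-- The formula `chernForm` gives the unique connection satisfying the conditions that
characterize the Chern connection. -/
theorem isChernForm_iff {E : Type*} [NormedAddCommGroup E] [NormedSpace ℂ E]
    [FiniteDimensional ℂ E] (G : E → E →L[ℝ] E →L[ℝ] ℝ) (y : E) (hd : DifferentiableAt ℝ G y)
    (hsymm : ∀ᶠ y' in 𝓝 y, ∀ v w, G y' v w = G y' w v)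
    (hJ : ∀ᶠ y' in 𝓝 y, ∀ v w, G y' (mulI E v) (mulI E w) = G y' v w)
    (hpos : ∀ v, v ≠ 0 → 0 < G y v v) (Γ : E →ₗ[ℝ] E →ₗ[ℝ] E) :
    IsChernForm G y Γ ↔ ∀ u v, Γ u v = chernForm G y u v := by
  have : FiniteDimensional ℝ E := FiniteDimensional.complexToReal E
  have hii : ∀ v : E, mulI E (mulI E v) = -v := by
    intro v; simp [mulI, smul_smul]
  have hdd : ∀ u v w, fderiv ℝ (fun y' => G y' v w) y u = fderiv ℝ G y u v w := by
    intro u v w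
    have h1 := (hd.hasFDerivAt.clm_apply (hasFDerivAt_const v y)).clm_apply
      (hasFDerivAt_const w y)
    rw [h1.fderiv]; simp
  have dsymm : ∀ u v w, fderiv ℝ G y u v w = fderiv ℝ G y u w v := by
    intro u v w
    rw [← hdd, ← hdd]
    have : (fun y' => G y' v w) =ᶠ[𝓝 y] (fun y' => G y' w v) := hsymm.mono fun y' h => h v w
    rw [this.fderiv_eq]
  have dJ : ∀ u v w, fderiv ℝ G y u (mulI E v) (mulI E w) = fderiv ℝ G y u v w := by
    intro u v w
    rw [← hdd, ← hdd]
    have : (fun y' => G y' (mulI E v) (mulI E w)) =ᶠ[𝓝 y] (fun y' => G y' v w) :=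
      hJ.mono fun y' h => h v w
    rw [this.fderiv_eq]
  have dJ' : ∀ u v w, fderiv ℝ G y u (mulI E v) w = - fderiv ℝ G y u v (mulI E w) := by
    intro u v w
    rw [← dJ u v (mulI E w), hii]; simp
  have dneg : ∀ u v w, fderiv ℝ G y (-u) v w = - fderiv ℝ G y u v w := by
    intro u v w
    rw [← hdd, ← hdd, map_neg]
  have hs := hsymm.self_of_nhds
  have gJ := hJ.self_of_nhds
  have gJ' : ∀ v w, G y (mulI E v) w = - G y v (mulI E w) := by
    intro v w
    rw [← gJ v (mulI E w), hii]; simp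
  have hinj : Function.Injective (G y) := by
    rw [injective_iff_map_eq_zero]
    intro v hv
    by_contra h
    have := hpos v h
    rw [hv] at this
    simp at this
  have hinv : ∀ φ : E →L[ℝ] ℝ, G y ((G y).inverse φ) = φ := by
    have hfr : Module.finrank ℝ E = Module.finrank ℝ (E →L[ℝ] ℝ) := by
      rw [← (LinearMap.toContinuousLinearMap : (E →ₗ[ℝ] ℝ) ≃ₗ[ℝ] _).finrank_eq]
      exact (Subspace.dual_finrank_eq (K := ℝ) (V := E)).symm
    let e : E ≃L[ℝ] (E →L[ℝ] ℝ) :=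
      (LinearEquiv.ofInjectiveOfFinrankEq (G y : E →ₗ[ℝ] (E →L[ℝ] ℝ)) hinj hfr).toContinuousLinearEquiv
    have he : G y = (e : E →L[ℝ] (E →L[ℝ] ℝ)) := by ext v w; rfl
    intro φ
    rw [he, ContinuousLinearMap.inverse_equiv]
    simp
  have hC : ∀ u v w, G y (chernForm G y u v) w =
      (1 / 2 : ℝ) * (fderiv ℝ G y u v w + fderiv ℝ G y (mulI E u) v (mulI E w)) := by
    intro u v w
    rw [chernForm, hinv]; simp; ring
  constructor
  · intro h u v
    have hB : ∀ u v, Γ (mulI E u) v - mulI E (Γ u v) = -(Γ (mulI E v) u - mulI E (Γ v u)) := by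
      intro u v
      have := h.torsion u v
      rw [h.parallel_J, h.parallel_J] at this
      rw [← sub_eq_zero] at this ⊢
      rw [← this]
      abel
    have hB1 : ∀ u v, Γ (mulI E u) (mulI E v) - mulI E (Γ u (mulI E v)) =
        mulI E (Γ (mulI E u) v - mulI E (Γ u v)) := by
      intro u v
      rw [h.parallel_J, h.parallel_J, map_sub]
    have hB2 : ∀ u v, Γ (mulI E (mulI E u)) v - mulI E (Γ (mulI E u) v) =
        - mulI E (Γ (mulI E u) v - mulI E (Γ u v)) := by
      intro u v
      rw [hii, map_sub, hii, map_neg, LinearMap.neg_apply]; abel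
    have hB0 : ∀ u v, Γ (mulI E u) v = mulI E (Γ u v) := by
      intro u v
      have e1 := hB1 u v
      rw [hB u (mulI E v), hB2 v u, hB v u, map_neg, neg_neg] at e1
      have e3 : mulI E (Γ (mulI E u) v - mulI E (Γ u v)) = 0 := by
        have h2 : (2 : ℝ) • mulI E (Γ (mulI E u) v - mulI E (Γ u v)) = 0 := by
          rw [two_smul]; nth_rewrite 1 [← e1]; exact neg_add_cancel _
        exact (smul_eq_zero.mp h2).resolve_left two_ne_zero
      have e4 := congrArg (mulI E) e3
      rw [hii, map_zero, neg_eq_zero, sub_eq_zero] at e4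
      exact e4
    apply hinj
    ext w
    rw [hC, h.parallel_metric, h.parallel_metric, hB0, hB0, gJ, h.parallel_J, hii, map_neg]
    ring
  · intro h
    refine ⟨?_, ?_, ?_⟩
    · intro u v
      apply hinj
      ext w
      rw [h, h, gJ', hC, hC, hii, dJ', dJ]
      simp
      ring
    · intro u v w
      rw [h, h, hs v, hC, hC, dsymm u w v, dsymm (mulI E u) w, dJ' _ v w]
      ring
    · have key : ∀ u v, Γ (mulI E u) v = mulI E (Γ u v) := by
        intro u v
        apply hinj
        ext w
        rw [h, h, gJ', hC, hC, hii, hii, dneg, map_neg]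
        ring
      have key2 : ∀ u v, Γ u (mulI E v) = mulI E (Γ u v) := by
        intro u v
        apply hinj
        ext w
        rw [h, h, gJ', hC, hC, hii, dJ', dJ]
        simp
        ring
      intro u v
      rw [key, key2, key, key2]

/-! ### Surfaces in Hermitian surfaces -/

section Surfaces

variable {E : Type*} [NormedAddCommGroup E] [NormedSpace ℂ E]
  {M : Type*} [TopologicalSpace M] [ChartedSpace E M]
  {S : Type*} [TopologicalSpace S] [ChartedSpace ℂ S]

/-- The differential `df_x : T_x S → T_{f x} M`. -/
abbrev differential (f : S → M) (x : S) :
    TangentSpace 𝓘(ℝ, ℂ) x →L[ℝ] TangentSpace 𝓘(ℝ, E) (f x) :=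
  mfderiv 𝓘(ℝ, ℂ) 𝓘(ℝ, E) f x

/-- `x` is a complex point: `df ∘ j = J ∘ df` at `x`. -/
def IsComplexPoint (E : Type*) [NormedAddCommGroup E] [NormedSpace ℂ E] {M : Type*}
    [TopologicalSpace M] [ChartedSpace E M] (f : S → M) (x : S) : Prop :=
  ∀ v : TangentSpace 𝓘(ℝ, ℂ) x, differential (E := E) f x (complexStructure ℂ x v) =
    complexStructure E (f x) (differential (E := E) f x v)

/-- `x` is an anticomplex point: `df ∘ j = - J ∘ df` at `x`. -/
def IsAnticomplexPoint (E : Type*) [NormedAddCommGroup E] [NormedSpace ℂ E] {M : Type*}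
    [TopologicalSpace M] [ChartedSpace E M] (f : S → M) (x : S) : Prop :=
  ∀ v : TangentSpace 𝓘(ℝ, ℂ) x, differential (E := E) f x (complexStructure ℂ x v) =
    - complexStructure E (f x) (differential (E := E) f x v)

/-- `x` is a real point: neither complex nor anticomplex. -/
def IsRealPoint (E : Type*) [NormedAddCommGroup E] [NormedSpace ℂ E] {M : Type*}
    [TopologicalSpace M] [ChartedSpace E M] (f : S → M) (x : S) : Prop :=
  ¬ IsComplexPoint E f x ∧ ¬ IsAnticomplexPoint E f x

/-- `f` is generic: neither holomorphic nor antiholomorphic. -/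
def IsGeneric (E : Type*) [NormedAddCommGroup E] [NormedSpace ℂ E] {M : Type*}
    [TopologicalSpace M] [ChartedSpace E M] (f : S → M) : Prop :=
  ¬ (∀ x, IsComplexPoint E f x) ∧ ¬ (∀ x, IsAnticomplexPoint E f x)

variable [IsManifold 𝓘(ℂ, E) ω M]

/-- The tensor `h^* g` for a map `h` from a real vector space to `M`. For `h` the inverse of a
chart of `M` this is the coordinate matrix of `g`; for `h = f ∘ e⁻¹`, with `e` a chart of `S`, it
is the coordinate matrix of the induced metric `f^* g`. -/
def pullbackMetric (g : HermitianMetric E M) {V : Type*} [NormedAddCommGroup V] [NormedSpace ℝ V]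
    (h : V → M) (y : V) : V →L[ℝ] V →L[ℝ] ℝ :=
  ContinuousLinearMap.bilinearComp (E := E) (F := E) (g.inner (h y))
    (mfderiv 𝓘(ℝ, V) 𝓘(ℝ, E) h y) (mfderiv 𝓘(ℝ, V) 𝓘(ℝ, E) h y)

/-- `f` is a smooth conformal immersion: the induced metric `f^* g` is invariant under `j`. -/
structure IsConformalImmersion (g : HermitianMetric E M) (f : S → M) : Prop where
  smooth : ContMDiff 𝓘(ℝ, ℂ) 𝓘(ℝ, E) ∞ f
  immersion : ∀ x, Function.Injective (differential (E := E) f x)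
  conformal : ∀ (x : S) (u v : TangentSpace 𝓘(ℝ, ℂ) x),
    g.inner (f x) (differential f x (complexStructure ℂ x u))
        (differential f x (complexStructure ℂ x v)) =
      g.inner (f x) (differential f x u) (differential f x v)

/-- The second fundamental form `(∇df)(u, v) = ∇_u (df(v)) - df(D_u v)` at the coordinate
`z`, in charts `e` of `S` and `e'` of `M`; here `∇` is the Chern connection of `M` and `D` the
Levi-Civita connection of the induced metric. -/
def chernSecondFundamentalForm (g : HermitianMetric E M) (f : S → M)
    (e : OpenPartialHomeomorph S ℂ) (e' : OpenPartialHomeomorph M E) (z u v : ℂ) : E :=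
  let F : ℂ → E := e' ∘ f ∘ e.symm
  fderiv ℝ (fun z' => fderiv ℝ F z' v) z u
    + chernForm (pullbackMetric g e'.symm) (F z) (fderiv ℝ F z u) (fderiv ℝ F z v)
    - fderiv ℝ F z (leviCivita (pullbackMetric g (f ∘ e.symm)) z u v)

/-- `f` is Chern minimal: `tr ∇df = 0`, where the trace is taken with respect to the induced
metric (in an orthonormal basis `u, v`). -/
def IsChernMinimal (g : HermitianMetric E M) (f : S → M) : Prop :=
  ∀ e ∈ atlas ℂ S, ∀ e' ∈ atlas E M, ∀ z ∈ e.target, f (e.symm z) ∈ e'.source →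
    ∀ u v : ℂ, pullbackMetric g (f ∘ e.symm) z u u = 1 →
      pullbackMetric g (f ∘ e.symm) z v v = 1 → pullbackMetric g (f ∘ e.symm) z u v = 0 →
      chernSecondFundamentalForm g f e e' z u u + chernSecondFundamentalForm g f e e' z v v = 0

/-- The Kähler angle `α ∈ [0, π]`: `cos α = g(J df(e), df(je))` for a unit vector `e`, that is,
`f^* ω = cos α dA` with `ω = g(J·, ·)`. (In a unitary coframe with `f^* ω¹ = s φ` and
`f^* ω² = t φ̄` this reads `|s| = cos (α / 2)`, `|t| = sin (α / 2)`.) -/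
def kahlerAngle (g : HermitianMetric E M) (f : S → M) (x : S) : ℝ :=
  let a : TangentSpace 𝓘(ℝ, E) (f x) := differential f x (1 : ℂ)
  let b : TangentSpace 𝓘(ℝ, E) (f x) := differential f x (Complex.I : ℂ)
  Real.arccos (g.inner (f x) (complexStructure E (f x) a) b / g.inner (f x) a a)

/-- The Gaussian curvature `K` of the induced metric `f^* g` at `x`. -/
def gaussCurvature (g : HermitianMetric E M) (f : S → M) (x : S) : ℝ :=
  sectionalCurvature (pullbackMetric g (f ∘ (chartAt ℂ x).symm)) (chartAt ℂ x x) 1 Complex.I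

/-- The normal curvature `K^⊥ = ⟨R^⊥(e₁, e₂) e₄, e₃⟩` at `x`, where `(e₁, e₂)` is an oriented
orthonormal basis of the tangent plane, `R^⊥` is the curvature of the normal connection induced
by the Levi-Civita connection of `M`, and `(e₃, e₄)` is an orthonormal basis of the normal plane
such that `(e₁, e₂, e₃, e₄)` is positively oriented; the value does not depend on the choice. -/
def normalCurvature (g : HermitianMetric E M) (f : S → M) (x : S) : ℝ :=
  let F : ℂ → E := chartAt E (f x) ∘ f ∘ (chartAt ℂ x).symm
  let G := pullbackMetric g (chartAt E (f x)).symm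
  let z := chartAt ℂ x x
  let a := fderiv ℝ F z 1
  let b := fderiv ℝ F z Complex.I
  let n : E × E := Classical.epsilon fun n => IsOrientedNormalFrame (G (F z)) a b n.1 n.2
  G (F z) (normalBundleCurvature G F z n.2) n.1 / G (F z) a a

end Surfaces

end ChernSurface

end

/-!
In a holomorphic chart of the surface and a holomorphic chart of the target, the immersion becomes
a map `F` into `E` with derivatives `a = F_x`, `b = F_y` satisfying `|a|² = |b|² = l` and
`⟪a, b⟫ = 0` for the coordinate expression of the Hermitian metric. Put `w = ⟪J a, b⟫ = l cos α`;
the point is real exactly when `r = l² - w² > 0`, that is when `sin² α = r / l² > 0`. There the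
vectors `-(l J b + w a)` and `l J a - w b` are a conformal frame of the normal plane.

Chern minimality is a linear equation between `F_xx + F_yy` and the first derivatives of the metric
along `a` and `b`. It makes the connection form of this normal frame, for the normal part of the
Levi-Civita connection, equal to `½ * d log (l / r)`; all remaining first derivatives of the metric
cancel (`connectionForm_one`, `connectionForm_I`). The normal connection of a plane bundle has
curvature the exterior derivative of its connection form, so `l K⊥ = -½ Δ log (l / r)`
(`normalBundleCurvature_pairing`), while `l K = -½ Δ log l` for the conformal metric
(`sectionalCurvature_conformal`). Adding,

  `K + K⊥ = Δ log (sin² α) / (2 l)` at every real point (`gaussCurvature_add_normalCurvature`).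

If `f` is real and `α` is constant, the right-hand side vanishes. Conversely, if `K + K⊥ = 0`, then
`log (sin² α)` is harmonic near every real point, hence locally constant near a maximum of `sin² α`
by the strong maximum principle (`eventually_eq_of_isLocalMax_harmonic`). Genericity provides a real
point (`exists_isRealPoint`), so the maximum of `sin² α` over the compact surface is positive and
the set where it is attained is open and closed, hence everything (`exists_cosAngle_sq_eq`). Thus
`f` is real, and the continuous function `cos α`, whose square is constant, is constant by
connectedness.
-/

open Set Filter Topology Bundle Manifold
open scoped ContDiff

noncomputable section

namespace ChernSurface

set_option synthInstance.maxHeartbeats 200000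

variable {V : Type*} [NormedAddCommGroup V] [NormedSpace ℝ V]
variable {E : Type*} [NormedAddCommGroup E] [NormedSpace ℂ E]

/-! ### Coordinate metrics and their connections -/

theorem mulI_mulI (v : E) : mulI E (mulI E v) = -v := by
  simp [mulI, smul_smul]

theorem mulI_apply (v : E) : mulI E v = Complex.I • v := rfl

/-- A positive definite bilinear form on a finite-dimensional space is invertible, so that the
junk value of `ContinuousLinearMap.inverse` never occurs. -/
theorem apply_inverse_of_pos [FiniteDimensional ℝ V] {B : V →L[ℝ] V →L[ℝ] ℝ}
    (hpos : ∀ v, v ≠ 0 → 0 < B v v) (φ : V →L[ℝ] ℝ) : B (B.inverse φ) = φ := by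
  have hinj : Function.Injective B := by
    rw [injective_iff_map_eq_zero]
    intro v hv
    by_contra h
    have := hpos v h
    simp [hv] at this
  have hfr : Module.finrank ℝ V = Module.finrank ℝ (V →L[ℝ] ℝ) := by
    rw [← (LinearMap.toContinuousLinearMap : (V →ₗ[ℝ] ℝ) ≃ₗ[ℝ] _).finrank_eq]
    exact (Subspace.dual_finrank_eq (K := ℝ) (V := V)).symm
  let e : V ≃L[ℝ] (V →L[ℝ] ℝ) :=
    (LinearEquiv.ofInjectiveOfFinrankEq (B : V →ₗ[ℝ] (V →L[ℝ] ℝ)) hinj hfr).toContinuousLinearEquiv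
  have he : B = (e : V →L[ℝ] (V →L[ℝ] ℝ)) := by ext v w; rfl
  rw [he, ContinuousLinearMap.inverse_equiv]
  simp

/-- The defining relation of the Levi-Civita connection form. -/
theorem leviCivita_pairing [FiniteDimensional ℝ V] {G : V → V →L[ℝ] V →L[ℝ] ℝ} {y : V}
    (hpos : ∀ v, v ≠ 0 → 0 < G y v v) (u v w : V) :
    G y (leviCivita G y u v) w =
      (fderiv ℝ G y u v w + fderiv ℝ G y v u w - fderiv ℝ G y w u v) / 2 := by
  rw [leviCivita, apply_inverse_of_pos hpos]
  simp
  ring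

/-- The defining relation of the Chern connection form. -/
theorem chernForm_pairing [FiniteDimensional ℝ E] {G : E → E →L[ℝ] E →L[ℝ] ℝ} {y : E}
    (hpos : ∀ v, v ≠ 0 → 0 < G y v v) (u v w : E) :
    G y (chernForm G y u v) w =
      (fderiv ℝ G y u v w + fderiv ℝ G y (mulI E u) v (mulI E w)) / 2 := by
  rw [chernForm, apply_inverse_of_pos hpos]
  simp
  ring

/-- `G` is the coordinate matrix of a Hermitian metric on the open set `U`. -/
structure IsHermitianOn (G : E → E →L[ℝ] E →L[ℝ] ℝ) (U : Set E) : Prop where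
  isOpen : IsOpen U
  smooth : ContDiffOn ℝ ∞ G U
  symm : ∀ y ∈ U, ∀ v w, G y v w = G y w v
  mulI : ∀ y ∈ U, ∀ v w, G y (mulI E v) (mulI E w) = G y v w
  pos : ∀ y ∈ U, ∀ v, v ≠ 0 → 0 < G y v v

namespace IsHermitianOn

variable {G : E → E →L[ℝ] E →L[ℝ] ℝ} {U : Set E} (hG : IsHermitianOn G U)
include hG

theorem mulI_left {y : E} (hy : y ∈ U) (v w : E) :
    G y (ChernSurface.mulI E v) w = -G y v (ChernSurface.mulI E w) := by
  rw [← hG.mulI y hy v, mulI_mulI]; simp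

theorem differentiableAt {y : E} (hy : y ∈ U) : DifferentiableAt ℝ G y :=
  (hG.smooth.contDiffAt (hG.isOpen.mem_nhds hy)).differentiableAt (by simp)

theorem fderiv_apply₂ {y : E} (hy : y ∈ U) (u v w : E) :
    fderiv ℝ (fun y' => G y' v w) y u = fderiv ℝ G y u v w := by
  have h1 := ((hG.differentiableAt hy).hasFDerivAt.clm_apply
    (hasFDerivAt_const v y)).clm_apply (hasFDerivAt_const w y)
  rw [h1.fderiv]; simp

theorem fderiv_symm {y : E} (hy : y ∈ U) (u v w : E) :
    fderiv ℝ G y u v w = fderiv ℝ G y u w v := by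
  rw [← hG.fderiv_apply₂ hy, ← hG.fderiv_apply₂ hy]
  have : (fun y' => G y' v w) =ᶠ[𝓝 y] (fun y' => G y' w v) := by
    filter_upwards [hG.isOpen.mem_nhds hy] with y' h using hG.symm y' h v w
  rw [this.fderiv_eq]

theorem fderiv_mulI {y : E} (hy : y ∈ U) (u v w : E) :
    fderiv ℝ G y u (ChernSurface.mulI E v) (ChernSurface.mulI E w) = fderiv ℝ G y u v w := by
  rw [← hG.fderiv_apply₂ hy, ← hG.fderiv_apply₂ hy]
  have : (fun y' => G y' (ChernSurface.mulI E v) (ChernSurface.mulI E w)) =ᶠ[𝓝 y]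
      (fun y' => G y' v w) := by
    filter_upwards [hG.isOpen.mem_nhds hy] with y' h using hG.mulI y' h v w
  rw [this.fderiv_eq]

theorem fderiv_mulI_left {y : E} (hy : y ∈ U) (u v w : E) :
    fderiv ℝ G y u (ChernSurface.mulI E v) w = -fderiv ℝ G y u v (ChernSurface.mulI E w) := by
  rw [← hG.fderiv_mulI hy u v, mulI_mulI]; simp

end IsHermitianOn

/-! ### Fields along a surface -/

/-- The covariant derivative `D_u W` of a field `W` along `F`, for the Levi-Civita connection of
the metric `G` of the target. -/
def covDeriv (G : E → E →L[ℝ] E →L[ℝ] ℝ) (F : ℂ → E) (u : ℂ) (W : ℂ → E) (z : ℂ) : E :=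
  fderiv ℝ W z u + leviCivita G (F z) (fderiv ℝ F z u) (W z)

theorem normalDeriv_eq (G : E → E →L[ℝ] E →L[ℝ] ℝ) (F : ℂ → E) (u : ℂ) (W : ℂ → E) (z : ℂ) :
    normalDeriv G F u W z = normalProj G F z (covDeriv G F u W z) := rfl

/-- The metric `G` on `U` and the conformal immersion `F : O → U` form a Chern minimal surface in
coordinates. The Levi-Civita connection of the induced metric does not enter the trace of the
second fundamental form, since the coordinate `z` is conformal. -/
structure IsChernMinimalPatch (G : E → E →L[ℝ] E →L[ℝ] ℝ) (U : Set E) (F : ℂ → E) (O : Set ℂ) :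
    Prop where
  metric : IsHermitianOn G U
  isOpen : IsOpen O
  smooth : ContDiffOn ℝ ∞ F O
  mapsTo : MapsTo F O U
  immersion : ∀ z ∈ O, fderiv ℝ F z 1 ≠ 0
  norm_eq : ∀ z ∈ O, G (F z) (fderiv ℝ F z 1) (fderiv ℝ F z 1) =
    G (F z) (fderiv ℝ F z Complex.I) (fderiv ℝ F z Complex.I)
  orth : ∀ z ∈ O, G (F z) (fderiv ℝ F z 1) (fderiv ℝ F z Complex.I) = 0
  minimal : ∀ z ∈ O, fderiv ℝ (fun z' => fderiv ℝ F z' 1) z 1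
      + chernForm G (F z) (fderiv ℝ F z 1) (fderiv ℝ F z 1)
      + (fderiv ℝ (fun z' => fderiv ℝ F z' Complex.I) z Complex.I
      + chernForm G (F z) (fderiv ℝ F z Complex.I) (fderiv ℝ F z Complex.I)) = 0

/-- The conformal factor `λ = |F_x|²`. -/
def confFactor (G : E → E →L[ℝ] E →L[ℝ] ℝ) (F : ℂ → E) (z : ℂ) : ℝ :=
  G (F z) (fderiv ℝ F z 1) (fderiv ℝ F z 1)

/-- The coefficient `⟨J F_x, F_y⟩ = λ cos α` of the pulled back Kähler form. -/
def kahlerFactor (G : E → E →L[ℝ] E →L[ℝ] ℝ) (F : ℂ → E) (z : ℂ) : ℝ :=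
  G (F z) (mulI E (fderiv ℝ F z 1)) (fderiv ℝ F z Complex.I)

/-- `λ² - ⟨J F_x, F_y⟩² = λ² sin² α`, which is positive exactly at the real points. -/
def realFactor (G : E → E →L[ℝ] E →L[ℝ] ℝ) (F : ℂ → E) (z : ℂ) : ℝ :=
  confFactor G F z ^ 2 - kahlerFactor G F z ^ 2

/-- The normal field `- (λ J F_y + ⟨J F_x, F_y⟩ F_x)`, a multiple of the normal part of `J F_y`. -/
def normalField₁ (G : E → E →L[ℝ] E →L[ℝ] ℝ) (F : ℂ → E) (z : ℂ) : E :=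
  -(confFactor G F z • mulI E (fderiv ℝ F z Complex.I) + kahlerFactor G F z • fderiv ℝ F z 1)

/-- The normal field `λ J F_x - ⟨J F_x, F_y⟩ F_y`, a multiple of the normal part of `J F_x`. -/
def normalField₂ (G : E → E →L[ℝ] E →L[ℝ] ℝ) (F : ℂ → E) (z : ℂ) : E :=
  confFactor G F z • mulI E (fderiv ℝ F z 1) - kahlerFactor G F z • fderiv ℝ F z Complex.I

namespace IsChernMinimalPatch

variable {G : E → E →L[ℝ] E →L[ℝ] ℝ} {U : Set E} {F : ℂ → E} {O : Set ℂ}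

section
variable (h : IsChernMinimalPatch G U F O)
include h

theorem contDiffAt {z : ℂ} (hz : z ∈ O) : ContDiffAt ℝ ∞ F z :=
  h.smooth.contDiffAt (h.isOpen.mem_nhds hz)

theorem contDiffAt_fderiv {z : ℂ} (hz : z ∈ O) (v : ℂ) :
    ContDiffAt ℝ ∞ (fun z' => fderiv ℝ F z' v) z :=
  ((h.contDiffAt hz).fderiv_right (m := ∞) (by simp)).clm_apply contDiffAt_const

theorem differentiableAt {z : ℂ} (hz : z ∈ O) : DifferentiableAt ℝ F z :=
  (h.contDiffAt hz).differentiableAt (by simp)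

theorem contDiffAt_metric {z : ℂ} (hz : z ∈ O) : ContDiffAt ℝ ∞ (fun z' => G (F z')) z :=
  ContDiffAt.comp z (h.metric.smooth.contDiffAt (h.metric.isOpen.mem_nhds (h.mapsTo hz)))
    (h.contDiffAt hz)

theorem contDiffAt_pairing {z : ℂ} (hz : z ∈ O) {A B : ℂ → E} (hA : ContDiffAt ℝ ∞ A z)
    (hB : ContDiffAt ℝ ∞ B z) : ContDiffAt ℝ ∞ (fun z' => G (F z') (A z') (B z')) z :=
  ((h.contDiffAt_metric hz).clm_apply hA).clm_apply hB

theorem contDiffAt_confFactor {z : ℂ} (hz : z ∈ O) : ContDiffAt ℝ ∞ (confFactor G F) z :=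
  h.contDiffAt_pairing hz (h.contDiffAt_fderiv hz 1) (h.contDiffAt_fderiv hz 1)

theorem contDiffAt_mulI_fderiv {z : ℂ} (hz : z ∈ O) (v : ℂ) :
    ContDiffAt ℝ ∞ (fun z' => mulI E (fderiv ℝ F z' v)) z :=
  (mulI E).contDiff.contDiffAt.comp z (h.contDiffAt_fderiv hz v)

theorem contDiffAt_kahlerFactor {z : ℂ} (hz : z ∈ O) : ContDiffAt ℝ ∞ (kahlerFactor G F) z :=
  h.contDiffAt_pairing hz (h.contDiffAt_mulI_fderiv hz 1) (h.contDiffAt_fderiv hz _)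

theorem contDiffAt_realFactor {z : ℂ} (hz : z ∈ O) : ContDiffAt ℝ ∞ (realFactor G F) z :=
  ((h.contDiffAt_confFactor hz).pow 2).sub ((h.contDiffAt_kahlerFactor hz).pow 2)

theorem contDiffAt_normalField₁ {z : ℂ} (hz : z ∈ O) : ContDiffAt ℝ ∞ (normalField₁ G F) z :=
  (((h.contDiffAt_confFactor hz).smul (h.contDiffAt_mulI_fderiv hz _)).add
    ((h.contDiffAt_kahlerFactor hz).smul (h.contDiffAt_fderiv hz _))).neg

theorem contDiffAt_normalField₂ {z : ℂ} (hz : z ∈ O) : ContDiffAt ℝ ∞ (normalField₂ G F) z :=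
  ((h.contDiffAt_confFactor hz).smul (h.contDiffAt_mulI_fderiv hz _)).sub
    ((h.contDiffAt_kahlerFactor hz).smul (h.contDiffAt_fderiv hz _))

theorem confFactor_pos {z : ℂ} (hz : z ∈ O) : 0 < confFactor G F z :=
  h.metric.pos _ (h.mapsTo hz) _ (h.immersion z hz)

theorem fderiv_pairing {z : ℂ} (hz : z ∈ O) {A B : ℂ → E} (hA : DifferentiableAt ℝ A z)
    (hB : DifferentiableAt ℝ B z) (u : ℂ) :
    fderiv ℝ (fun z' => G (F z') (A z') (B z')) z u =
      fderiv ℝ G (F z) (fderiv ℝ F z u) (A z) (B z) + G (F z) (fderiv ℝ A z u) (B z)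
        + G (F z) (A z) (fderiv ℝ B z u) := by
  have h1 : HasFDerivAt (fun z' => G (F z')) ((fderiv ℝ G (F z)).comp (fderiv ℝ F z)) z :=
    HasFDerivAt.comp (g := G) z (h.metric.differentiableAt (h.mapsTo hz)).hasFDerivAt
      (h.differentiableAt hz).hasFDerivAt
  have h2 := (h1.clm_apply hA.hasFDerivAt).clm_apply hB.hasFDerivAt
  rw [h2.fderiv]
  simp
  ring

/-- The Levi-Civita connection is metric. -/
theorem fderiv_pairing_eq_covDeriv [FiniteDimensional ℝ E] {z : ℂ} (hz : z ∈ O) {A B : ℂ → E}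
    (hA : DifferentiableAt ℝ A z) (hB : DifferentiableAt ℝ B z) (u : ℂ) :
    fderiv ℝ (fun z' => G (F z') (A z') (B z')) z u =
      G (F z) (covDeriv G F u A z) (B z) + G (F z) (A z) (covDeriv G F u B z) := by
  have hy := h.mapsTo hz
  rw [h.fderiv_pairing hz hA hB, h.metric.symm _ hy (A z) (covDeriv G F u B z)]
  simp only [covDeriv, map_add, add_apply]
  rw [leviCivita_pairing (h.metric.pos _ hy), leviCivita_pairing (h.metric.pos _ hy),
    h.metric.symm _ hy (A z), h.metric.fderiv_symm hy _ (B z) (A z),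
    h.metric.fderiv_symm hy (A z) _ (B z), h.metric.fderiv_symm hy (B z) _ (A z)]
  ring

theorem fderiv_fderiv_comm {z : ℂ} (hz : z ∈ O) (u v : ℂ) :
    fderiv ℝ (fun z' => fderiv ℝ F z' v) z u = fderiv ℝ (fun z' => fderiv ℝ F z' u) z v := by
  have hd : DifferentiableAt ℝ (fderiv ℝ F) z :=
    ((h.contDiffAt hz).fderiv_right (m := ∞) (by simp)).differentiableAt (by simp)
  have hs : IsSymmSndFDerivAt ℝ F z := (h.contDiffAt hz).isSymmSndFDerivAt
    (by simpa using ENat.LEInfty.out)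
  rw [fderiv_clm_apply hd (by fun_prop), fderiv_clm_apply hd (by fun_prop)]
  simpa using hs.eq u v

end

end IsChernMinimalPatch

theorem leviCivita_add (G : V → V →L[ℝ] V →L[ℝ] ℝ) (y u v w : V) :
    leviCivita G y u (v + w) = leviCivita G y u v + leviCivita G y u w := by
  simp only [leviCivita, ← map_add, ← smul_add]
  congr 2
  ext x
  simp
  ring

theorem leviCivita_smul (G : V → V →L[ℝ] V →L[ℝ] ℝ) (y u v : V) (c : ℝ) :
    leviCivita G y u (c • v) = c • leviCivita G y u v := by
  simp only [leviCivita, ← map_smul, smul_comm c (1 / 2 : ℝ)]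
  congr 2
  ext x
  simp
  ring

theorem covDeriv_add {G : E → E →L[ℝ] E →L[ℝ] ℝ} {F : ℂ → E} {u : ℂ} {A B : ℂ → E} {z : ℂ}
    (hA : DifferentiableAt ℝ A z) (hB : DifferentiableAt ℝ B z) :
    covDeriv G F u (fun z' => A z' + B z') z = covDeriv G F u A z + covDeriv G F u B z := by
  simp only [covDeriv, leviCivita_add]
  rw [fderiv_fun_add hA hB, add_apply]
  abel

theorem covDeriv_smul {G : E → E →L[ℝ] E →L[ℝ] ℝ} {F : ℂ → E} {u : ℂ} {c : ℂ → ℝ} {A : ℂ → E}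
    {z : ℂ} (hc : DifferentiableAt ℝ c z) (hA : DifferentiableAt ℝ A z) :
    covDeriv G F u (fun z' => c z' • A z') z =
      fderiv ℝ c z u • A z + c z • covDeriv G F u A z := by
  simp only [covDeriv, leviCivita_smul]
  rw [fderiv_fun_smul hc hA]
  simp only [add_apply, smul_apply, ContinuousLinearMap.smulRight_apply,
    smul_add]
  abel

theorem covDeriv_neg {G : E → E →L[ℝ] E →L[ℝ] ℝ} {F : ℂ → E} {u : ℂ} {A : ℂ → E} {z : ℂ} :
    covDeriv G F u (fun z' => -A z') z = -covDeriv G F u A z := by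
  simp only [covDeriv]
  rw [fderiv_fun_neg, ← neg_one_smul ℝ (A z), leviCivita_smul]
  simp
  abel

theorem covDeriv_congr {G : E → E →L[ℝ] E →L[ℝ] ℝ} {F : ℂ → E} {u : ℂ} {A B : ℂ → E} {z : ℂ}
    (hAB : A =ᶠ[𝓝 z] B) : covDeriv G F u A z = covDeriv G F u B z := by
  simp only [covDeriv, hAB.fderiv_eq, hAB.eq_of_nhds]

theorem IsHermitianOn.pair_mulI_self {G : E → E →L[ℝ] E →L[ℝ] ℝ} {U : Set E}
    (hG : IsHermitianOn G U) {y : E} (hy : y ∈ U) (v : E) : G y v (ChernSurface.mulI E v) = 0 := by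
  have h1 := hG.mulI_left hy v v
  have h2 := hG.symm y hy v (ChernSurface.mulI E v)
  linarith

theorem IsHermitianOn.fderiv_pair_mulI_self {G : E → E →L[ℝ] E →L[ℝ] ℝ} {U : Set E}
    (hG : IsHermitianOn G U) {y : E} (hy : y ∈ U) (u v : E) :
    fderiv ℝ G y u v (ChernSurface.mulI E v) = 0 := by
  have h1 := hG.fderiv_mulI_left hy u v v
  have h2 := hG.fderiv_symm hy u v (ChernSurface.mulI E v)
  linarith

namespace IsChernMinimalPatch

variable {G : E → E →L[ℝ] E →L[ℝ] ℝ} {U : Set E} {F : ℂ → E} {O : Set ℂ}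
variable (h : IsChernMinimalPatch G U F O)
include h

/-! ### The normal frame -/

theorem pair_y_x {z : ℂ} (hz : z ∈ O) :
    G (F z) (fderiv ℝ F z Complex.I) (fderiv ℝ F z 1) = 0 := by
  rw [h.metric.symm _ (h.mapsTo hz), h.orth z hz]

theorem pair_x_mulI_y {z : ℂ} (hz : z ∈ O) :
    G (F z) (fderiv ℝ F z 1) (mulI E (fderiv ℝ F z Complex.I)) = -kahlerFactor G F z := by
  rw [kahlerFactor, h.metric.mulI_left (h.mapsTo hz), neg_neg]

theorem pair_y_mulI_x {z : ℂ} (hz : z ∈ O) :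
    G (F z) (fderiv ℝ F z Complex.I) (mulI E (fderiv ℝ F z 1)) = kahlerFactor G F z := by
  rw [kahlerFactor, h.metric.symm _ (h.mapsTo hz)]

theorem pair_y_y {z : ℂ} (hz : z ∈ O) :
    G (F z) (fderiv ℝ F z Complex.I) (fderiv ℝ F z Complex.I) = confFactor G F z :=
  (h.norm_eq z hz).symm

omit h in
/-- The definition of `confFactor`, oriented for rewriting. -/
theorem pair_x_x (G : E → E →L[ℝ] E →L[ℝ] ℝ) (F : ℂ → E) (z : ℂ) :
    G (F z) (fderiv ℝ F z 1) (fderiv ℝ F z 1) = confFactor G F z := rfl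

theorem normalField₁_x {z : ℂ} (hz : z ∈ O) :
    G (F z) (normalField₁ G F z) (fderiv ℝ F z 1) = 0 := by
  have hy := h.mapsTo hz
  simp only [normalField₁, map_neg, map_add, map_smul, neg_apply, add_apply, smul_apply,
    smul_eq_mul, h.metric.mulI_left hy, h.pair_y_mulI_x hz, pair_x_x]
  ring

theorem normalField₁_y {z : ℂ} (hz : z ∈ O) :
    G (F z) (normalField₁ G F z) (fderiv ℝ F z Complex.I) = 0 := by
  have hy := h.mapsTo hz
  simp only [normalField₁, map_neg, map_add, map_smul, neg_apply, add_apply, smul_apply,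
    smul_eq_mul, h.metric.mulI_left hy, h.metric.pair_mulI_self hy, h.orth z hz]
  ring

theorem normalField₂_x {z : ℂ} (hz : z ∈ O) :
    G (F z) (normalField₂ G F z) (fderiv ℝ F z 1) = 0 := by
  have hy := h.mapsTo hz
  simp only [normalField₂, map_sub, map_smul, sub_apply, smul_apply,
    smul_eq_mul, h.metric.mulI_left hy, h.metric.pair_mulI_self hy, h.pair_y_x hz]
  ring

theorem normalField₂_y {z : ℂ} (hz : z ∈ O) :
    G (F z) (normalField₂ G F z) (fderiv ℝ F z Complex.I) = 0 := by
  have hy := h.mapsTo hz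
  simp only [normalField₂, map_sub, map_smul, sub_apply, smul_apply,
    smul_eq_mul, h.metric.mulI_left hy, h.pair_x_mulI_y hz, h.pair_y_y hz]
  ring

theorem normalField₁_normalField₁ {z : ℂ} (hz : z ∈ O) :
    G (F z) (normalField₁ G F z) (normalField₁ G F z) = confFactor G F z * realFactor G F z := by
  have hy := h.mapsTo hz
  conv_lhs => enter [2]; rw [normalField₁]
  simp only [map_neg, map_add, map_smul, smul_eq_mul, h.normalField₁_x hz]
  simp only [normalField₁, map_neg, map_add, map_smul, neg_apply, add_apply, smul_apply,
    smul_eq_mul, h.metric.mulI _ hy, h.pair_x_mulI_y hz, h.pair_y_y hz, realFactor]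
  ring

theorem normalField₂_normalField₂ {z : ℂ} (hz : z ∈ O) :
    G (F z) (normalField₂ G F z) (normalField₂ G F z) = confFactor G F z * realFactor G F z := by
  have hy := h.mapsTo hz
  conv_lhs => enter [2]; rw [normalField₂]
  simp only [map_sub, map_smul, smul_eq_mul, h.normalField₂_y hz]
  simp only [normalField₂, map_sub, map_smul, sub_apply, smul_apply,
    smul_eq_mul, h.metric.mulI _ hy, h.pair_y_mulI_x hz, pair_x_x, realFactor]
  ring

theorem normalField₁_normalField₂ {z : ℂ} (hz : z ∈ O) :
    G (F z) (normalField₁ G F z) (normalField₂ G F z) = 0 := by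
  have hy := h.mapsTo hz
  conv_lhs => enter [2]; rw [normalField₂]
  simp only [map_sub, map_smul, smul_eq_mul, h.normalField₁_y hz]
  simp only [normalField₁, map_neg, map_add, map_smul, neg_apply, add_apply, smul_apply,
    smul_eq_mul, h.metric.mulI _ hy, h.metric.pair_mulI_self hy, h.pair_y_x hz]
  ring

/-! ### The connection form of the normal frame -/

/-- The part of `⟨D_u N₁, N₂⟩` that does not involve derivatives of the factors. -/
theorem covDeriv_normalField₁_normalField₂ [FiniteDimensional ℝ E] {z : ℂ} (hz : z ∈ O) (u : ℂ) :
    G (F z) (covDeriv G F u (normalField₁ G F) z) (normalField₂ G F z) =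
      -(confFactor G F z * (G (F z)
          (covDeriv G F u (fun z' => mulI E (fderiv ℝ F z' Complex.I)) z) (normalField₂ G F z))
        + kahlerFactor G F z * (G (F z)
          (covDeriv G F u (fun z' => fderiv ℝ F z' 1) z) (normalField₂ G F z))) := by
  have hy := h.mapsTo hz
  have hl := (h.contDiffAt_confFactor hz).differentiableAt (by simp)
  have hw := (h.contDiffAt_kahlerFactor hz).differentiableAt (by simp)
  have hb := (h.contDiffAt_mulI_fderiv hz Complex.I).differentiableAt (by simp)
  have ha := (h.contDiffAt_fderiv hz 1).differentiableAt (by simp)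
  have e : covDeriv G F u (normalField₁ G F) z = _ :=
    covDeriv_neg.trans (congrArg _ (covDeriv_add (hl.smul hb) (hw.smul ha)))
  rw [e, covDeriv_smul hl hb, covDeriv_smul hw ha]
  have e1 : G (F z) (mulI E (fderiv ℝ F z Complex.I)) (normalField₂ G F z) = 0 := by
    simp only [normalField₂, map_sub, map_smul, smul_eq_mul, h.metric.mulI _ hy, h.pair_y_x hz]
    simp only [h.metric.mulI_left hy, h.metric.pair_mulI_self hy]
    ring
  have e2 : G (F z) (fderiv ℝ F z 1) (normalField₂ G F z) = 0 := by
    rw [h.metric.symm _ hy, h.normalField₂_x hz]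
  simp only [map_neg, map_add, map_smul, neg_apply, add_apply, smul_apply,
    smul_eq_mul, e1, e2]
  ring

theorem fderiv_confFactor {z : ℂ} (hz : z ∈ O) (u : ℂ) :
    fderiv ℝ (confFactor G F) z u =
      fderiv ℝ G (F z) (fderiv ℝ F z u) (fderiv ℝ F z 1) (fderiv ℝ F z 1)
        + 2 * G (F z) (fderiv ℝ (fun z' => fderiv ℝ F z' 1) z u) (fderiv ℝ F z 1) := by
  have hd := (h.contDiffAt_fderiv hz 1).differentiableAt (by simp)
  rw [show confFactor G F = fun z' => G (F z') (fderiv ℝ F z' 1) (fderiv ℝ F z' 1) from rfl,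
    h.fderiv_pairing hz hd hd, h.metric.symm _ (h.mapsTo hz) (fderiv ℝ F z 1)]
  ring

theorem fderiv_confFactor' {z : ℂ} (hz : z ∈ O) (u : ℂ) :
    fderiv ℝ (confFactor G F) z u =
      fderiv ℝ G (F z) (fderiv ℝ F z u) (fderiv ℝ F z Complex.I) (fderiv ℝ F z Complex.I)
        + 2 * G (F z) (fderiv ℝ (fun z' => fderiv ℝ F z' Complex.I) z u)
          (fderiv ℝ F z Complex.I) := by
  have hd := (h.contDiffAt_fderiv hz Complex.I).differentiableAt (by simp)
  have : confFactor G F =ᶠ[𝓝 z]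
      fun z' => G (F z') (fderiv ℝ F z' Complex.I) (fderiv ℝ F z' Complex.I) := by
    filter_upwards [h.isOpen.mem_nhds hz] with z' hz' using h.norm_eq z' hz'
  rw [this.fderiv_eq, h.fderiv_pairing hz hd hd,
    h.metric.symm _ (h.mapsTo hz) (fderiv ℝ F z Complex.I)]
  ring

theorem fderiv_orth {z : ℂ} (hz : z ∈ O) (u : ℂ) :
    fderiv ℝ G (F z) (fderiv ℝ F z u) (fderiv ℝ F z 1) (fderiv ℝ F z Complex.I)
        + G (F z) (fderiv ℝ (fun z' => fderiv ℝ F z' 1) z u) (fderiv ℝ F z Complex.I)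
        + G (F z) (fderiv ℝ (fun z' => fderiv ℝ F z' Complex.I) z u) (fderiv ℝ F z 1) = 0 := by
  have : (fun z' => G (F z') (fderiv ℝ F z' 1) (fderiv ℝ F z' Complex.I)) =ᶠ[𝓝 z]
      fun _ => (0 : ℝ) := by
    filter_upwards [h.isOpen.mem_nhds hz] with z' hz' using h.orth z' hz'
  have h2 := h.fderiv_pairing hz ((h.contDiffAt_fderiv hz 1).differentiableAt (by simp))
    ((h.contDiffAt_fderiv hz Complex.I).differentiableAt (by simp)) u
  rw [this.fderiv_eq, h.metric.symm _ (h.mapsTo hz) (fderiv ℝ F z 1) (fderiv ℝ _ z u)] at h2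
  simpa using h2.symm

theorem fderiv_kahlerFactor {z : ℂ} (hz : z ∈ O) (u : ℂ) :
    fderiv ℝ (kahlerFactor G F) z u =
      -fderiv ℝ G (F z) (fderiv ℝ F z u) (fderiv ℝ F z 1) (mulI E (fderiv ℝ F z Complex.I))
        - G (F z) (fderiv ℝ (fun z' => fderiv ℝ F z' 1) z u) (mulI E (fderiv ℝ F z Complex.I))
        + G (F z) (fderiv ℝ (fun z' => fderiv ℝ F z' Complex.I) z u)
          (mulI E (fderiv ℝ F z 1)) := by
  have hy := h.mapsTo hz
  have hd := (h.contDiffAt_fderiv hz 1).differentiableAt (by simp)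
  have e : fderiv ℝ (fun z' => mulI E (fderiv ℝ F z' 1)) z u =
      mulI E (fderiv ℝ (fun z' => fderiv ℝ F z' 1) z u) := by
    have := ((mulI E).hasFDerivAt.comp z hd.hasFDerivAt).fderiv
    exact congrArg (fun T => T u) this
  rw [show kahlerFactor G F =
      fun z' => G (F z') (mulI E (fderiv ℝ F z' 1)) (fderiv ℝ F z' Complex.I) from rfl,
    h.fderiv_pairing hz ((h.contDiffAt_mulI_fderiv hz 1).differentiableAt (by simp))
      ((h.contDiffAt_fderiv hz Complex.I).differentiableAt (by simp)), e,
    h.metric.fderiv_mulI_left hy, h.metric.mulI_left hy,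
    h.metric.symm _ hy (mulI E _) (fderiv ℝ _ z u)]
  ring

theorem fderiv_realFactor {z : ℂ} (hz : z ∈ O) (u : ℂ) :
    fderiv ℝ (realFactor G F) z u = 2 * confFactor G F z * fderiv ℝ (confFactor G F) z u
      - 2 * kahlerFactor G F z * fderiv ℝ (kahlerFactor G F) z u := by
  have hl := (h.contDiffAt_confFactor hz).differentiableAt (by simp)
  have hw := (h.contDiffAt_kahlerFactor hz).differentiableAt (by simp)
  have := ((hl.hasFDerivAt.pow 2).sub (hw.hasFDerivAt.pow 2)).fderiv
  have e : realFactor G F =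
      (fun x => confFactor G F x ^ 2) - fun x => kahlerFactor G F x ^ 2 := rfl
  rw [e, this]
  simp

/-- Chern minimality, tested against a vector. -/
theorem minimal_pairing [FiniteDimensional ℝ E] {z : ℂ} (hz : z ∈ O) (w : E) :
    G (F z) (fderiv ℝ (fun z' => fderiv ℝ F z' 1) z 1) w
      + G (F z) (fderiv ℝ (fun z' => fderiv ℝ F z' Complex.I) z Complex.I) w
      + (fderiv ℝ G (F z) (fderiv ℝ F z 1) (fderiv ℝ F z 1) w
        + fderiv ℝ G (F z) (mulI E (fderiv ℝ F z 1)) (fderiv ℝ F z 1) (mulI E w)) / 2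
      + (fderiv ℝ G (F z) (fderiv ℝ F z Complex.I) (fderiv ℝ F z Complex.I) w
        + fderiv ℝ G (F z) (mulI E (fderiv ℝ F z Complex.I)) (fderiv ℝ F z Complex.I)
          (mulI E w)) / 2 = 0 := by
  have hp := h.metric.pos _ (h.mapsTo hz)
  have := congrArg (fun v => G (F z) v w) (h.minimal z hz)
  simp only [map_add, add_apply, map_zero, zero_apply, chernForm_pairing hp] at this
  linarith

theorem covDeriv_mulI_pairing [FiniteDimensional ℝ E] {z : ℂ} (hz : z ∈ O) (u v : ℂ) (w : E) :
    G (F z) (covDeriv G F u (fun z' => mulI E (fderiv ℝ F z' v)) z) w =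
      -G (F z) (fderiv ℝ (fun z' => fderiv ℝ F z' v) z u) (mulI E w)
        + (fderiv ℝ G (F z) (fderiv ℝ F z u) (mulI E (fderiv ℝ F z v)) w
          + fderiv ℝ G (F z) (mulI E (fderiv ℝ F z v)) (fderiv ℝ F z u) w
          - fderiv ℝ G (F z) w (fderiv ℝ F z u) (mulI E (fderiv ℝ F z v))) / 2 := by
  have hd := (h.contDiffAt_fderiv hz v).differentiableAt (by simp)
  have e : fderiv ℝ (fun z' => mulI E (fderiv ℝ F z' v)) z u =
      mulI E (fderiv ℝ (fun z' => fderiv ℝ F z' v) z u) := by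
    have := ((mulI E).hasFDerivAt.comp z hd.hasFDerivAt).fderiv
    exact congrArg (fun T => T u) this
  rw [covDeriv, e, map_add, add_apply, leviCivita_pairing (h.metric.pos _ (h.mapsTo hz)),
    h.metric.mulI_left (h.mapsTo hz)]

theorem covDeriv_fderiv_pairing [FiniteDimensional ℝ E] {z : ℂ} (hz : z ∈ O) (u v : ℂ) (w : E) :
    G (F z) (covDeriv G F u (fun z' => fderiv ℝ F z' v) z) w =
      G (F z) (fderiv ℝ (fun z' => fderiv ℝ F z' v) z u) w
        + (fderiv ℝ G (F z) (fderiv ℝ F z u) (fderiv ℝ F z v) w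
          + fderiv ℝ G (F z) (fderiv ℝ F z v) (fderiv ℝ F z u) w
          - fderiv ℝ G (F z) w (fderiv ℝ F z u) (fderiv ℝ F z v)) / 2 := by
  rw [covDeriv, map_add, add_apply, leviCivita_pairing (h.metric.pos _ (h.mapsTo hz))]

/-- For a Chern minimal surface the connection form of the normal frame is half the conjugate
differential of the logarithm of `λ / (λ² - ⟨J F_x, F_y⟩²)`; this is its `∂_x` component. -/
theorem connectionForm_one [FiniteDimensional ℝ E] {z : ℂ} (hz : z ∈ O) :
    2 * G (F z) (covDeriv G F 1 (normalField₁ G F) z) (normalField₂ G F z) =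
      fderiv ℝ (confFactor G F) z Complex.I * realFactor G F z
        - confFactor G F z * fderiv ℝ (realFactor G F) z Complex.I := by
  have hy := h.mapsTo hz
  rw [h.covDeriv_normalField₁_normalField₂ hz, h.covDeriv_mulI_pairing hz,
    h.covDeriv_fderiv_pairing hz, h.fderiv_realFactor hz, realFactor]
  have h3 := h.fderiv_confFactor hz Complex.I
  have h4 := h.fderiv_confFactor' hz Complex.I
  have h5 := h.fderiv_orth hz 1
  have h8 := h.fderiv_kahlerFactor hz Complex.I
  have m2 := h.minimal_pairing hz (fderiv ℝ F z Complex.I)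
  have m3 := h.minimal_pairing hz (mulI E (fderiv ℝ F z 1))
  rw [← h.fderiv_fderiv_comm hz 1 Complex.I] at h3 h8
  have hba := fun u => h.metric.fderiv_symm hy u (fderiv ℝ F z Complex.I) (fderiv ℝ F z 1)
  have hbJa : ∀ u, fderiv ℝ G (F z) u (fderiv ℝ F z Complex.I) (mulI E (fderiv ℝ F z 1)) =
      -fderiv ℝ G (F z) u (fderiv ℝ F z 1) (mulI E (fderiv ℝ F z Complex.I)) := fun u => by
    rw [h.metric.fderiv_symm hy, h.metric.fderiv_mulI_left hy]
  simp only [normalField₂, map_sub, map_smul, smul_eq_mul, mulI_mulI, map_neg, sub_apply,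
    smul_apply, h.metric.fderiv_mulI_left hy, h.metric.fderiv_pair_mulI_self hy, hba, hbJa]
    at m2 m3 ⊢
  -- The coefficients solve a linear system in the derivatives of the metric and the second
  -- derivatives of `F`: Chern minimality tested against `F_y` and `J F_x` suffices.
  linear_combination (kahlerFactor G F z ^ 2) * h3 + (confFactor G F z ^ 2) * h4
    - 2 * (confFactor G F z ^ 2 - kahlerFactor G F z ^ 2) * h5
    - 2 * confFactor G F z * kahlerFactor G F z * h8
    + 2 * confFactor G F z ^ 2 * m2 - 2 * confFactor G F z * kahlerFactor G F z * m3

/-- The `∂_y` component of the connection form; see `connectionForm_one`. -/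
theorem connectionForm_I [FiniteDimensional ℝ E] {z : ℂ} (hz : z ∈ O) :
    2 * G (F z) (covDeriv G F Complex.I (normalField₁ G F) z) (normalField₂ G F z) =
      -(fderiv ℝ (confFactor G F) z 1 * realFactor G F z
        - confFactor G F z * fderiv ℝ (realFactor G F) z 1) := by
  have hy := h.mapsTo hz
  rw [h.covDeriv_normalField₁_normalField₂ hz, h.covDeriv_mulI_pairing hz,
    h.covDeriv_fderiv_pairing hz, h.fderiv_realFactor hz, realFactor]
  have h1 := h.fderiv_confFactor hz 1
  have h2 := h.fderiv_confFactor' hz 1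
  have h7 := h.fderiv_kahlerFactor hz 1
  have m1 := h.minimal_pairing hz (fderiv ℝ F z 1)
  have m4 := h.minimal_pairing hz (mulI E (fderiv ℝ F z Complex.I))
  rw [h.fderiv_fderiv_comm hz Complex.I 1]
  have hba := fun u => h.metric.fderiv_symm hy u (fderiv ℝ F z Complex.I) (fderiv ℝ F z 1)
  have hbJa : ∀ u, fderiv ℝ G (F z) u (fderiv ℝ F z Complex.I) (mulI E (fderiv ℝ F z 1)) =
      -fderiv ℝ G (F z) u (fderiv ℝ F z 1) (mulI E (fderiv ℝ F z Complex.I)) := fun u => by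
    rw [h.metric.fderiv_symm hy, h.metric.fderiv_mulI_left hy]
  simp only [normalField₂, map_sub, map_smul, smul_eq_mul, mulI_mulI, map_neg, sub_apply,
    smul_apply, h.metric.fderiv_mulI_left hy, h.metric.fderiv_pair_mulI_self hy, hba, hbJa]
    at m1 m4 ⊢
  -- Here Chern minimality is tested against `F_x` and `J F_y`.
  linear_combination (-confFactor G F z ^ 2) * h1 - (kahlerFactor G F z ^ 2) * h2
    + 2 * confFactor G F z * kahlerFactor G F z * h7
    - 2 * confFactor G F z ^ 2 * m1 - 2 * confFactor G F z * kahlerFactor G F z * m4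

end IsChernMinimalPatch

/-! ### The normal curvature -/

/-- A vector orthogonal to as many nonzero, mutually orthogonal vectors as the dimension is zero. -/
theorem eq_zero_of_orthogonal {n : ℕ} [FiniteDimensional ℝ V] (hV : Module.finrank ℝ V = n)
    {B : V →L[ℝ] V →L[ℝ] ℝ} (hpos : ∀ v, v ≠ 0 → 0 < B v v) {v : Fin n → V}
    (hv : ∀ i, v i ≠ 0) (horth : ∀ i j, i ≠ j → B (v i) (v j) = 0) {d : V}
    (hd : ∀ i, B (v i) d = 0) : d = 0 := by
  have hli : LinearIndependent ℝ v := by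
    rw [Fintype.linearIndependent_iff]
    intro c hc j
    have h1 := congrArg (fun w => B w (v j)) hc
    simp only [map_sum, map_smul, sum_apply, smul_apply, smul_eq_mul, map_zero,
      zero_apply] at h1
    rw [Finset.sum_eq_single j (fun i _ hij => by rw [horth i j hij, mul_zero]) (by simp)] at h1
    exact (mul_eq_zero.mp h1).resolve_right (hpos _ (hv j)).ne'
  have hspan : d ∈ Submodule.span ℝ (Set.range v) := by
    rw [hli.span_eq_top_of_card_eq_finrank' (by simp [hV])]
    trivial
  obtain ⟨c, rfl⟩ := (Submodule.mem_span_range_iff_exists_fun ℝ).mp hspan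
  by_contra hne
  have h1 := hpos _ hne
  have h2 : B (∑ i, c i • v i) (∑ i, c i • v i) = 0 := by
    conv_lhs => enter [1]; rw [map_sum]
    rw [sum_apply]
    exact Finset.sum_eq_zero fun i _ => by rw [map_smul, smul_apply, hd i, smul_zero]
  linarith

/-- The common squared norm of the two normal fields. -/
def frameNorm (G : E → E →L[ℝ] E →L[ℝ] ℝ) (F : ℂ → E) (z : ℂ) : ℝ :=
  confFactor G F z * realFactor G F z

/-- The connection form `θ(u) = ⟨D_u N₁, N₂⟩ / |N₁|²` of the normal frame. -/
def connectionForm (G : E → E →L[ℝ] E →L[ℝ] ℝ) (F : ℂ → E) (u z : ℂ) : ℝ :=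
  G (F z) (covDeriv G F u (normalField₁ G F) z) (normalField₂ G F z) / frameNorm G F z

/-- The dilation form `σ(u) = ½ ∂_u log |N₁|²` of the normal frame. -/
def dilationForm (G : E → E →L[ℝ] E →L[ℝ] ℝ) (F : ℂ → E) (u z : ℂ) : ℝ :=
  fderiv ℝ (frameNorm G F) z u / (2 * frameNorm G F z)

theorem normalProj_of_orthogonal {G : E → E →L[ℝ] E →L[ℝ] ℝ} {F : ℂ → E} {z : ℂ} {n : E}
    (h1 : G (F z) n (fderiv ℝ F z 1) = 0) (h2 : G (F z) n (fderiv ℝ F z Complex.I) = 0) :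
    normalProj G F z n = n := by
  simp [normalProj, h1, h2]

theorem normalDeriv_congr {G : E → E →L[ℝ] E →L[ℝ] ℝ} {F : ℂ → E} {u : ℂ} {A B : ℂ → E} {z : ℂ}
    (hAB : A =ᶠ[𝓝 z] B) : normalDeriv G F u A z = normalDeriv G F u B z := by
  rw [normalDeriv_eq, normalDeriv_eq, covDeriv_congr hAB]

namespace IsChernMinimalPatch

variable {G : E → E →L[ℝ] E →L[ℝ] ℝ} {U : Set E} {F : ℂ → E} {O : Set ℂ}
variable (h : IsChernMinimalPatch G U F O)
include h

theorem realFactor_nonneg {z : ℂ} (hz : z ∈ O) : 0 ≤ realFactor G F z := by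
  have hl := h.confFactor_pos hz
  have hn := h.normalField₁_normalField₁ hz
  by_cases h0 : normalField₁ G F z = 0
  · rw [h0, map_zero] at hn
    have := (mul_eq_zero.mp hn.symm).resolve_left hl.ne'
    exact this.ge
  · have := h.metric.pos _ (h.mapsTo hz) _ h0
    rw [hn] at this
    exact (pos_of_mul_pos_right this hl.le).le

theorem contDiffAt_frameNorm {z : ℂ} (hz : z ∈ O) : ContDiffAt ℝ ∞ (frameNorm G F) z :=
  (h.contDiffAt_confFactor hz).mul (h.contDiffAt_realFactor hz)

variable (hreal : ∀ z ∈ O, realFactor G F z ≠ 0)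
include hreal

theorem realFactor_pos {z : ℂ} (hz : z ∈ O) : 0 < realFactor G F z :=
  (h.realFactor_nonneg hz).lt_of_ne (hreal z hz).symm

theorem frameNorm_pos {z : ℂ} (hz : z ∈ O) : 0 < frameNorm G F z :=
  mul_pos (h.confFactor_pos hz) (h.realFactor_pos hreal hz)

theorem normalField₁_ne_zero {z : ℂ} (hz : z ∈ O) : normalField₁ G F z ≠ 0 := by
  intro h0
  have h1 := h.normalField₁_normalField₁ hz
  rw [h0, map_zero] at h1
  exact (h.frameNorm_pos hreal hz).ne h1

theorem normalField₂_ne_zero {z : ℂ} (hz : z ∈ O) : normalField₂ G F z ≠ 0 := by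
  intro h0
  have h1 := h.normalField₂_normalField₂ hz
  rw [h0, map_zero] at h1
  exact (h.frameNorm_pos hreal hz).ne h1

variable [FiniteDimensional ℝ E] (hE : Module.finrank ℝ E = 4)
include hE

theorem normalProj_eq {z : ℂ} (hz : z ∈ O) (w : E) :
    normalProj G F z w =
      (G (F z) w (normalField₁ G F z) / frameNorm G F z) • normalField₁ G F z
      + (G (F z) w (normalField₂ G F z) / frameNorm G F z) • normalField₂ G F z := by
  have hy := h.mapsTo hz
  have hm := (h.frameNorm_pos hreal hz).ne'
  have hl := (h.confFactor_pos hz).ne'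
  have hs := h.metric.symm _ hy
  have e11 : _ = frameNorm G F z := h.normalField₁_normalField₁ hz
  have e22 : _ = frameNorm G F z := h.normalField₂_normalField₂ hz
  have e12 := h.normalField₁_normalField₂ hz
  have e21 := (hs _ _).trans e12
  have e1x := h.normalField₁_x hz
  have e1y := h.normalField₁_y hz
  have e2x := h.normalField₂_x hz
  have e2y := h.normalField₂_y hz
  have ex1 := (hs _ _).trans e1x
  have ey1 := (hs _ _).trans e1y
  have ex2 := (hs _ _).trans e2x
  have ey2 := (hs _ _).trans e2y
  have exy := h.orth z hz
  have eyx := h.pair_y_x hz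
  have exx := pair_x_x G F z
  have eyy := h.pair_y_y hz
  have hy0 : fderiv ℝ F z Complex.I ≠ 0 := by
    intro h0
    rw [h0, map_zero] at eyy
    exact hl eyy.symm
  rw [← sub_eq_zero]
  refine eq_zero_of_orthogonal hE (h.metric.pos _ hy)
    (v := ![fderiv ℝ F z 1, fderiv ℝ F z Complex.I, normalField₁ G F z, normalField₂ G F z])
    ?_ ?_ ?_
  · intro i
    fin_cases i
    exacts [h.immersion z hz, hy0, h.normalField₁_ne_zero hreal hz, h.normalField₂_ne_zero hreal hz]
  · intro i j hij
    fin_cases i <;> fin_cases j <;> first | exact absurd rfl hij | assumption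
  · intro i
    fin_cases i <;>
      simp only [normalProj, map_sub, map_add, map_smul, smul_eq_mul, Fin.zero_eta,
        Matrix.cons_val_zero, Fin.mk_one, Matrix.cons_val_one, Fin.reduceFinMk, Matrix.cons_val,
        e11, e22, e12, e21, e1x, e1y, e2x, e2y, ex1, ex2, ey1, ey2, exy, eyx, exx, eyy]
    · rw [hs _ w]; field_simp; ring
    · rw [hs _ w]; field_simp; ring
    · rw [hs _ w]; field_simp; ring
    · rw [hs _ w]; field_simp; ring

omit hE hreal in
theorem covDeriv_normalField₁_self {z : ℂ} (hz : z ∈ O) (u : ℂ) :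
    2 * G (F z) (covDeriv G F u (normalField₁ G F) z) (normalField₁ G F z) =
      fderiv ℝ (frameNorm G F) z u := by
  have hd := (h.contDiffAt_normalField₁ hz).differentiableAt (by simp)
  have : frameNorm G F =ᶠ[𝓝 z] fun z' => G (F z') (normalField₁ G F z') (normalField₁ G F z') := by
    filter_upwards [h.isOpen.mem_nhds hz] with z' hz' using (h.normalField₁_normalField₁ hz').symm
  rw [this.fderiv_eq, h.fderiv_pairing_eq_covDeriv hz hd hd,
    h.metric.symm _ (h.mapsTo hz) (normalField₁ G F z)]
  ring

omit hE hreal in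
theorem covDeriv_normalField₂_self {z : ℂ} (hz : z ∈ O) (u : ℂ) :
    2 * G (F z) (covDeriv G F u (normalField₂ G F) z) (normalField₂ G F z) =
      fderiv ℝ (frameNorm G F) z u := by
  have hd := (h.contDiffAt_normalField₂ hz).differentiableAt (by simp)
  have : frameNorm G F =ᶠ[𝓝 z] fun z' => G (F z') (normalField₂ G F z') (normalField₂ G F z') := by
    filter_upwards [h.isOpen.mem_nhds hz] with z' hz' using (h.normalField₂_normalField₂ hz').symm
  rw [this.fderiv_eq, h.fderiv_pairing_eq_covDeriv hz hd hd,
    h.metric.symm _ (h.mapsTo hz) (normalField₂ G F z)]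
  ring

omit hE hreal in
theorem covDeriv_normalField₂_normalField₁ {z : ℂ} (hz : z ∈ O) (u : ℂ) :
    G (F z) (covDeriv G F u (normalField₂ G F) z) (normalField₁ G F z) =
      -G (F z) (covDeriv G F u (normalField₁ G F) z) (normalField₂ G F z) := by
  have hd1 := (h.contDiffAt_normalField₁ hz).differentiableAt (by simp)
  have hd2 := (h.contDiffAt_normalField₂ hz).differentiableAt (by simp)
  have : (fun z' => G (F z') (normalField₁ G F z') (normalField₂ G F z')) =ᶠ[𝓝 z]
      fun _ => (0 : ℝ) := by
    filter_upwards [h.isOpen.mem_nhds hz] with z' hz' using h.normalField₁_normalField₂ hz'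
  have h2 := h.fderiv_pairing_eq_covDeriv hz hd1 hd2 u
  rw [this.fderiv_eq, h.metric.symm _ (h.mapsTo hz) (normalField₁ G F z)] at h2
  simp at h2
  linarith

/-- In the normal frame the normal connection has the matrix `σ + θ j`, with `j` the rotation
`N₁ ↦ N₂ ↦ -N₁`. -/
theorem normalDeriv_frame {z : ℂ} (hz : z ∈ O) (u : ℂ) {α β : ℂ → ℝ}
    (hα : DifferentiableAt ℝ α z) (hβ : DifferentiableAt ℝ β z) :
    normalDeriv G F u (fun z' => α z' • normalField₁ G F z' + β z' • normalField₂ G F z') z =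
      (fderiv ℝ α z u + α z * dilationForm G F u z - β z * connectionForm G F u z)
        • normalField₁ G F z
      + (fderiv ℝ β z u + β z * dilationForm G F u z + α z * connectionForm G F u z)
        • normalField₂ G F z := by
  have hm := (h.frameNorm_pos hreal hz).ne'
  have hd1 := (h.contDiffAt_normalField₁ hz).differentiableAt (by simp)
  have hd2 := (h.contDiffAt_normalField₂ hz).differentiableAt (by simp)
  have e11 : _ = frameNorm G F z := h.normalField₁_normalField₁ hz
  have e22 : _ = frameNorm G F z := h.normalField₂_normalField₂ hz
  have e12 := h.normalField₁_normalField₂ hz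
  have e21 := (h.metric.symm _ (h.mapsTo hz) _ _).trans e12
  have c11 := h.covDeriv_normalField₁_self hz u
  have c22 := h.covDeriv_normalField₂_self hz u
  have c21 := h.covDeriv_normalField₂_normalField₁ hz u
  rw [normalDeriv_eq, h.normalProj_eq hreal hE hz, covDeriv_add (hα.fun_smul hd1) (hβ.fun_smul hd2),
    covDeriv_smul hα hd1, covDeriv_smul hβ hd2]
  simp only [map_add, map_smul, add_apply, smul_apply, smul_eq_mul, e11, e12, e21, e22, c21,
    dilationForm, connectionForm, ← c11]
  rw [show G (F z) (covDeriv G F u (normalField₂ G F) z) (normalField₂ G F z) =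
    G (F z) (covDeriv G F u (normalField₁ G F) z) (normalField₁ G F z) by linarith]
  congr 2
  · field_simp
    ring
  · field_simp
    ring

end IsChernMinimalPatch

theorem laplacian_eq {f : ℂ → ℝ} {z : ℂ} (hf : ContDiffAt ℝ 2 f z) :
    Laplacian.laplacian f z = fderiv ℝ (fun z' => fderiv ℝ f z' 1) z 1
      + fderiv ℝ (fun z' => fderiv ℝ f z' Complex.I) z Complex.I := by
  have hd : DifferentiableAt ℝ (fderiv ℝ f) z :=
    (hf.fderiv_right (m := 1) (by norm_num)).differentiableAt (by simp)
  rw [InnerProductSpace.laplacian_eq_iteratedFDeriv_complexPlane,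
    fderiv_clm_apply hd (by fun_prop), fderiv_clm_apply hd (by fun_prop)]
  simp [iteratedFDeriv_two_apply]

/-- The derivative of a component `∂_u α + α σ - β θ` of a normal derivative. -/
theorem fderiv_component {α β σ θ : ℂ → ℝ} {z : ℂ} (hα : ContDiffAt ℝ 2 α z)
    (hβ : DifferentiableAt ℝ β z) (hσ : DifferentiableAt ℝ σ z) (hθ : DifferentiableAt ℝ θ z)
    (u v : ℂ) :
    DifferentiableAt ℝ (fun z' => fderiv ℝ α z' u + α z' * σ z' - β z' * θ z') z ∧
    fderiv ℝ (fun z' => fderiv ℝ α z' u + α z' * σ z' - β z' * θ z') z v =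
      fderiv ℝ (fderiv ℝ α) z v u + (fderiv ℝ α z v * σ z + α z * fderiv ℝ σ z v)
        - (fderiv ℝ β z v * θ z + β z * fderiv ℝ θ z v) := by
  have h1 : HasFDerivAt (fun z' => fderiv ℝ α z' u)
      ((fderiv ℝ (fderiv ℝ α) z).flip u) z := by
    have hd : DifferentiableAt ℝ (fderiv ℝ α) z :=
      (hα.fderiv_right (m := 1) (by norm_num)).differentiableAt (by simp)
    have := hd.hasFDerivAt.clm_apply (hasFDerivAt_const u z)
    convert! this using 1
    ext w
    simp
  have hα' := hα.differentiableAt (by simp)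
  have h2 := (h1.add (hα'.hasFDerivAt.mul hσ.hasFDerivAt)).sub (hβ.hasFDerivAt.mul hθ.hasFDerivAt)
  refine ⟨h2.differentiableAt, ?_⟩
  have h3 : fderiv ℝ (fun z' => fderiv ℝ α z' u + α z' * σ z' - β z' * θ z') z = _ := h2.fderiv
  rw [h3]
  simp
  ring

namespace IsChernMinimalPatch

variable {G : E → E →L[ℝ] E →L[ℝ] ℝ} {U : Set E} {F : ℂ → E} {O : Set ℂ}
variable (h : IsChernMinimalPatch G U F O)
include h
variable (hreal : ∀ z ∈ O, realFactor G F z ≠ 0)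
include hreal

theorem contDiffAt_dilationForm {z : ℂ} (hz : z ∈ O) (u : ℂ) :
    ContDiffAt ℝ ∞ (dilationForm G F u) z :=
  (((h.contDiffAt_frameNorm hz).fderiv_right (m := ∞) (by simp)).clm_apply contDiffAt_const).div
    (contDiffAt_const.mul (h.contDiffAt_frameNorm hz))
    (mul_ne_zero two_ne_zero (h.frameNorm_pos hreal hz).ne')

/-- The logarithm of `λ / (λ² sin² α)`; half of its conjugate differential is the connection form
of the normal frame. -/
def logFactor (G : E → E →L[ℝ] E →L[ℝ] ℝ) (F : ℂ → E) (z : ℂ) : ℝ :=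
  Real.log (confFactor G F z) - Real.log (realFactor G F z)

theorem contDiffAt_logFactor {z : ℂ} (hz : z ∈ O) : ContDiffAt ℝ ∞ (logFactor G F) z :=
  ((h.contDiffAt_confFactor hz).log (h.confFactor_pos hz).ne').sub
    ((h.contDiffAt_realFactor hz).log (h.realFactor_pos hreal hz).ne')

theorem fderiv_logFactor {z : ℂ} (hz : z ∈ O) (u : ℂ) :
    fderiv ℝ (logFactor G F) z u = fderiv ℝ (confFactor G F) z u / confFactor G F z
      - fderiv ℝ (realFactor G F) z u / realFactor G F z := by
  have h1 := ((h.contDiffAt_confFactor hz).differentiableAt (by simp)).hasFDerivAt.log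
    (h.confFactor_pos hz).ne'
  have h2 := ((h.contDiffAt_realFactor hz).differentiableAt (by simp)).hasFDerivAt.log
    (h.realFactor_pos hreal hz).ne'
  have h3 : fderiv ℝ (logFactor G F) z = _ := (h1.sub h2).fderiv
  rw [h3]
  simp
  ring

variable [FiniteDimensional ℝ E]

theorem connectionForm_one_eq {z : ℂ} (hz : z ∈ O) :
    connectionForm G F 1 z = fderiv ℝ (logFactor G F) z Complex.I / 2 := by
  have h1 := (h.confFactor_pos hz).ne'
  have h2 := (h.realFactor_pos hreal hz).ne'
  have h3 := h.connectionForm_one hz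
  rw [h.fderiv_logFactor hreal hz, connectionForm, frameNorm]
  field_simp
  linarith

theorem connectionForm_I_eq {z : ℂ} (hz : z ∈ O) :
    connectionForm G F Complex.I z = -(fderiv ℝ (logFactor G F) z 1 / 2) := by
  have h1 := (h.confFactor_pos hz).ne'
  have h2 := (h.realFactor_pos hreal hz).ne'
  have h3 := h.connectionForm_I hz
  rw [h.fderiv_logFactor hreal hz, connectionForm, frameNorm]
  field_simp
  linarith

theorem fderiv_connectionForm {z : ℂ} (hz : z ∈ O) :
    fderiv ℝ (connectionForm G F Complex.I) z 1 - fderiv ℝ (connectionForm G F 1) z Complex.I =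
      -(Laplacian.laplacian (logFactor G F) z) / 2 := by
  have h1 : connectionForm G F 1 =ᶠ[𝓝 z]
      fun z' => (1 / 2 : ℝ) * fderiv ℝ (logFactor G F) z' Complex.I := by
    filter_upwards [h.isOpen.mem_nhds hz] with z' hz'
    rw [h.connectionForm_one_eq hreal hz']; ring
  have h2 : connectionForm G F Complex.I =ᶠ[𝓝 z]
      fun z' => (-1 / 2 : ℝ) * fderiv ℝ (logFactor G F) z' 1 := by
    filter_upwards [h.isOpen.mem_nhds hz] with z' hz'
    rw [h.connectionForm_I_eq hreal hz']; ring
  have hl (u : ℂ) : DifferentiableAt ℝ (fun z' => fderiv ℝ (logFactor G F) z' u) z :=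
    (((h.contDiffAt_logFactor hreal hz).fderiv_right (m := ∞) (by simp)).clm_apply
      contDiffAt_const).differentiableAt (by simp)
  rw [h1.fderiv_eq, h2.fderiv_eq, fderiv_const_mul (hl _), fderiv_const_mul (hl _),
    laplacian_eq ((h.contDiffAt_logFactor hreal hz).of_le ENat.LEInfty.out)]
  simp only [smul_apply, smul_eq_mul]
  ring

theorem differentiableAt_connectionForm {z : ℂ} (hz : z ∈ O) :
    DifferentiableAt ℝ (connectionForm G F 1) z ∧
      DifferentiableAt ℝ (connectionForm G F Complex.I) z := by
  have hl (u : ℂ) : DifferentiableAt ℝ (fun z' => fderiv ℝ (logFactor G F) z' u) z :=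
    (((h.contDiffAt_logFactor hreal hz).fderiv_right (m := ∞) (by simp)).clm_apply
      contDiffAt_const).differentiableAt (by simp)
  have h1 : DifferentiableAt ℝ (fun z' => fderiv ℝ (logFactor G F) z' Complex.I / 2) z := by
    simpa only [div_eq_inv_mul] using (hl Complex.I).const_mul (2 : ℝ)⁻¹
  have h2 : DifferentiableAt ℝ (fun z' => -(fderiv ℝ (logFactor G F) z' 1 / 2)) z := by
    simpa only [div_eq_inv_mul] using ((hl 1).const_mul (2 : ℝ)⁻¹).fun_neg
  constructor
  · refine h1.congr_of_eventuallyEq ?_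
    filter_upwards [h.isOpen.mem_nhds hz] with z' hz' using h.connectionForm_one_eq hreal hz'
  · refine h2.congr_of_eventuallyEq ?_
    filter_upwards [h.isOpen.mem_nhds hz] with z' hz' using h.connectionForm_I_eq hreal hz'

omit hreal [FiniteDimensional ℝ E] in
/-- The orientation form on two combinations of the normal fields. Its sign shows that
`(N₂, N₁)`, rather than `(N₁, N₂)`, is positively oriented. -/
theorem orientation_frame {z : ℂ} (hz : z ∈ O) (γ δ α β : ℝ) :
    G (F z) (mulI E (fderiv ℝ F z 1)) (fderiv ℝ F z Complex.I)
        * G (F z) (mulI E (γ • normalField₁ G F z + δ • normalField₂ G F z))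
          (α • normalField₁ G F z + β • normalField₂ G F z)
      - G (F z) (mulI E (fderiv ℝ F z 1)) (γ • normalField₁ G F z + δ • normalField₂ G F z)
        * G (F z) (mulI E (fderiv ℝ F z Complex.I))
          (α • normalField₁ G F z + β • normalField₂ G F z)
      + G (F z) (mulI E (fderiv ℝ F z 1)) (α • normalField₁ G F z + β • normalField₂ G F z)
        * G (F z) (mulI E (fderiv ℝ F z Complex.I))
          (γ • normalField₁ G F z + δ • normalField₂ G F z) =
      (δ * α - γ * β) * (realFactor G F z * confFactor G F z ^ 2) := by
  have hy := h.mapsTo hz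
  have hs := h.metric.symm _ hy
  have ja1 : G (F z) (mulI E (fderiv ℝ F z 1)) (normalField₁ G F z) = 0 := by
    simp only [normalField₁, map_neg, map_add, map_smul, smul_eq_mul, h.metric.mulI _ hy,
      h.orth z hz]
    simp only [h.metric.mulI_left hy, h.metric.pair_mulI_self hy]
    ring
  have ja2 : G (F z) (mulI E (fderiv ℝ F z 1)) (normalField₂ G F z) = realFactor G F z := by
    simp only [normalField₂, map_sub, map_smul, smul_eq_mul, h.metric.mulI _ hy,
      h.metric.mulI_left hy (fderiv ℝ F z 1) (fderiv ℝ F z Complex.I),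
      h.pair_x_mulI_y hz, realFactor, pair_x_x]
    ring
  have jb1 : G (F z) (mulI E (fderiv ℝ F z Complex.I)) (normalField₁ G F z) =
      -realFactor G F z := by
    simp only [normalField₁, map_neg, map_add, map_smul, smul_eq_mul, h.metric.mulI _ hy,
      h.metric.mulI_left hy (fderiv ℝ F z Complex.I) (fderiv ℝ F z 1),
      h.pair_y_mulI_x hz, realFactor, h.pair_y_y hz]
    ring
  have jb2 : G (F z) (mulI E (fderiv ℝ F z Complex.I)) (normalField₂ G F z) = 0 := by
    simp only [normalField₂, map_sub, map_smul, smul_eq_mul, h.metric.mulI _ hy, h.pair_y_x hz,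
      h.metric.mulI_left hy (fderiv ℝ F z Complex.I) (fderiv ℝ F z Complex.I),
      h.metric.pair_mulI_self hy]
    ring
  have j12 : G (F z) (mulI E (normalField₁ G F z)) (normalField₂ G F z) =
      -(kahlerFactor G F z * realFactor G F z) := by
    have : G (F z) (fderiv ℝ F z Complex.I) (normalField₂ G F z) = 0 :=
      (hs _ _).trans (h.normalField₂_y hz)
    conv_lhs => enter [1]; rw [normalField₁]
    simp only [map_neg, map_add, map_smul, neg_apply, add_apply, smul_apply, smul_eq_mul,
      mulI_mulI, this, ja2]
    ring
  have j11 : G (F z) (mulI E (normalField₁ G F z)) (normalField₁ G F z) = 0 := by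
    rw [hs, h.metric.pair_mulI_self hy]
  have j22 : G (F z) (mulI E (normalField₂ G F z)) (normalField₂ G F z) = 0 := by
    rw [hs, h.metric.pair_mulI_self hy]
  have j21 : G (F z) (mulI E (normalField₂ G F z)) (normalField₁ G F z) =
      kahlerFactor G F z * realFactor G F z := by
    rw [h.metric.mulI_left hy, hs, j12, neg_neg]
  simp only [map_add, map_smul, add_apply, smul_apply, smul_eq_mul, ja1, ja2, jb1, jb2, j11, j12,
    j21, j22]
  rw [show G (F z) (mulI E (fderiv ℝ F z 1)) (fderiv ℝ F z Complex.I) = kahlerFactor G F z from rfl,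
    realFactor]
  ring

variable (hE : Module.finrank ℝ E = 4)
include hE

/-- The curvature of the normal connection in the normal frame: `dσ + dθ j`. -/
theorem normalBundleCurvature_eq {z : ℂ} (hz : z ∈ O) (n : E) :
    normalBundleCurvature G F z n =
      (G (F z) n (normalField₁ G F z) / frameNorm G F z *
          (fderiv ℝ (dilationForm G F Complex.I) z 1 - fderiv ℝ (dilationForm G F 1) z Complex.I)
        - G (F z) n (normalField₂ G F z) / frameNorm G F z *
          (fderiv ℝ (connectionForm G F Complex.I) z 1
            - fderiv ℝ (connectionForm G F 1) z Complex.I)) • normalField₁ G F z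
      + (G (F z) n (normalField₂ G F z) / frameNorm G F z *
          (fderiv ℝ (dilationForm G F Complex.I) z 1 - fderiv ℝ (dilationForm G F 1) z Complex.I)
        + G (F z) n (normalField₁ G F z) / frameNorm G F z *
          (fderiv ℝ (connectionForm G F Complex.I) z 1
            - fderiv ℝ (connectionForm G F 1) z Complex.I)) • normalField₂ G F z := by
  set α : ℂ → ℝ := fun z' => G (F z') n (normalField₁ G F z') / frameNorm G F z'
  set β : ℂ → ℝ := fun z' => G (F z') n (normalField₂ G F z') / frameNorm G F z'
  have cα : ∀ z' ∈ O, ContDiffAt ℝ ∞ α z' := fun z' hz' =>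
    (h.contDiffAt_pairing hz' contDiffAt_const (h.contDiffAt_normalField₁ hz')).div
      (h.contDiffAt_frameNorm hz') (h.frameNorm_pos hreal hz').ne'
  have cβ : ∀ z' ∈ O, ContDiffAt ℝ ∞ β z' := fun z' hz' =>
    (h.contDiffAt_pairing hz' contDiffAt_const (h.contDiffAt_normalField₂ hz')).div
      (h.contDiffAt_frameNorm hz') (h.frameNorm_pos hreal hz').ne'
  have e0 : ∀ z' ∈ O, (fun z' => normalProj G F z' n) =ᶠ[𝓝 z']
      fun z' => α z' • normalField₁ G F z' + β z' • normalField₂ G F z' := fun z' hz' => by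
    filter_upwards [h.isOpen.mem_nhds hz'] with w hw using h.normalProj_eq hreal hE hw n
  have e1 (u : ℂ) : (normalDeriv G F u fun z' => normalProj G F z' n) =ᶠ[𝓝 z] fun z' =>
      (fderiv ℝ α z' u + α z' * dilationForm G F u z' - β z' * connectionForm G F u z')
        • normalField₁ G F z'
      + (fderiv ℝ β z' u + β z' * dilationForm G F u z' - (-α) z' * connectionForm G F u z')
        • normalField₂ G F z' := by
    filter_upwards [h.isOpen.mem_nhds hz] with w hw
    rw [normalDeriv_congr (e0 w hw), h.normalDeriv_frame hreal hE hw u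
      ((cα w hw).differentiableAt (by simp)) ((cβ w hw).differentiableAt (by simp))]
    congr 2
    simp
  obtain ⟨dθ1, dθI⟩ := h.differentiableAt_connectionForm hreal hz
  have dσ (u : ℂ) := (h.contDiffAt_dilationForm hreal hz u).differentiableAt (by simp)
  have dα := (cα z hz).differentiableAt (by simp)
  have dβ := (cβ z hz).differentiableAt (by simp)
  have cα2 : ContDiffAt ℝ 2 α z := (cα z hz).of_le ENat.LEInfty.out
  have cβ2 : ContDiffAt ℝ 2 β z := (cβ z hz).of_le ENat.LEInfty.out
  have sα := (cα2.isSymmSndFDerivAt (by simp)).eq 1 Complex.I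
  have sβ := (cβ2.isSymmSndFDerivAt (by simp)).eq 1 Complex.I
  have nα (v : ℂ) : fderiv ℝ (-α) z v = -fderiv ℝ α z v := by
    rw [fderiv_neg]; rfl
  obtain ⟨a1, a1'⟩ := fderiv_component cα2 dβ (dσ 1) dθ1 1 Complex.I
  obtain ⟨aI, aI'⟩ := fderiv_component cα2 dβ (dσ Complex.I) dθI Complex.I 1
  obtain ⟨b1, b1'⟩ := fderiv_component cβ2 dα.neg (dσ 1) dθ1 1 Complex.I
  obtain ⟨bI, bI'⟩ := fderiv_component cβ2 dα.neg (dσ Complex.I) dθI Complex.I 1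
  rw [normalBundleCurvature, normalDeriv_congr (e1 1), normalDeriv_congr (e1 Complex.I),
    h.normalDeriv_frame hreal hE hz _ a1 b1, h.normalDeriv_frame hreal hE hz _ aI bI,
    a1', aI', b1', bI', sα, sβ, nα, nα, add_sub_add_comm, ← sub_smul, ← sub_smul]
  simp only [Pi.neg_apply]
  congr 2 <;> ring

/-- For an oriented orthonormal normal frame only the rotation part `dθ` of the curvature
contributes. -/
theorem normalBundleCurvature_pairing {z : ℂ} (hz : z ∈ O) {n₁ n₂ : E}
    (hn : IsOrientedNormalFrame (G (F z)) (fderiv ℝ F z 1) (fderiv ℝ F z Complex.I) n₁ n₂) :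
    G (F z) (normalBundleCurvature G F z n₂) n₁ =
      -(Laplacian.laplacian (logFactor G F) z) / 2 := by
  have hm := h.frameNorm_pos hreal hz
  have hψ := h.realFactor_pos hreal hz
  have e11 : _ = frameNorm G F z := h.normalField₁_normalField₁ hz
  have e22 : _ = frameNorm G F z := h.normalField₂_normalField₂ hz
  have e12 := h.normalField₁_normalField₂ hz
  have e21 := (h.metric.symm _ (h.mapsTo hz) _ _).trans e12
  have p1 := normalProj_of_orthogonal hn.normal₁.1 hn.normal₁.2
  have p2 := normalProj_of_orthogonal hn.normal₂.1 hn.normal₂.2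
  rw [h.normalProj_eq hreal hE hz] at p1 p2
  rw [h.normalBundleCurvature_eq hreal hE hz, h.fderiv_connectionForm hreal hz]
  generalize G (F z) n₁ (normalField₁ G F z) / frameNorm G F z = γ at *
  generalize G (F z) n₁ (normalField₂ G F z) / frameNorm G F z = δ at *
  generalize G (F z) n₂ (normalField₁ G F z) / frameNorm G F z = α at *
  generalize G (F z) n₂ (normalField₂ G F z) / frameNorm G F z = β at *
  have hor := hn.oriented
  have j := h.orientation_frame hz γ δ α β
  have u1 := hn.unit₁
  have u2 := hn.unit₂
  have o12 := hn.orth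
  rw [← p1, ← p2, j] at hor
  rw [← p1, ← p2] at o12
  rw [← p1] at u1 ⊢
  rw [← p2] at u2
  simp only [map_add, map_smul, add_apply, smul_apply, smul_eq_mul, e11, e12, e21, e22]
    at u1 u2 o12 ⊢
  have hpos : 0 < δ * α - γ * β :=
    pos_of_mul_pos_left hor (mul_pos hψ (pow_pos (h.confFactor_pos hz) 2)).le
  have hsq : (frameNorm G F z * (δ * α - γ * β)) ^ 2 = 1 := by
    linear_combination (frameNorm G F z * (β ^ 2 + α ^ 2)) * u1 + u2
      - frameNorm G F z * (γ * α + δ * β) * o12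
  have hone : frameNorm G F z * (δ * α - γ * β) = 1 := by
    rcases mul_self_eq_one_iff.mp ((sq _).symm.trans hsq) with h1 | h1
    · exact h1
    · nlinarith [mul_pos hm hpos]
  generalize fderiv ℝ (dilationForm G F Complex.I) z 1
    - fderiv ℝ (dilationForm G F 1) z Complex.I = s
  linear_combination s * o12 + (-(Laplacian.laplacian (logFactor G F) z) / 2) * hone

omit hE [FiniteDimensional ℝ E] in
/-- Oriented orthonormal normal frames exist at real points, so that the frame chosen in the
definition of the normal curvature is not a junk value. -/
theorem exists_isOrientedNormalFrame {z : ℂ} (hz : z ∈ O) :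
    ∃ n : E × E, IsOrientedNormalFrame (G (F z)) (fderiv ℝ F z 1) (fderiv ℝ F z Complex.I)
      n.1 n.2 := by
  have hm := h.frameNorm_pos hreal hz
  have hr : (√(frameNorm G F z))⁻¹ * (√(frameNorm G F z))⁻¹ * frameNorm G F z = 1 := by
    rw [← mul_inv, Real.mul_self_sqrt hm.le, inv_mul_cancel₀ hm.ne']
  have hr0 : 0 < (√(frameNorm G F z))⁻¹ := inv_pos.mpr (Real.sqrt_pos.mpr hm)
  have e11 : _ = frameNorm G F z := h.normalField₁_normalField₁ hz
  have e22 : _ = frameNorm G F z := h.normalField₂_normalField₂ hz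
  have e21 := (h.metric.symm _ (h.mapsTo hz) _ _).trans (h.normalField₁_normalField₂ hz)
  have j := h.orientation_frame hz 0 (√(frameNorm G F z))⁻¹ (√(frameNorm G F z))⁻¹ 0
  simp only [zero_smul, zero_add, add_zero, zero_mul, sub_zero] at j
  generalize (√(frameNorm G F z))⁻¹ = r at *
  refine ⟨(r • normalField₂ G F z, r • normalField₁ G F z), ?_, ?_, ?_, ?_, ?_, ?_⟩
  · simp only [map_smul, smul_apply, smul_eq_mul, e22]
    linarith
  · simp only [map_smul, smul_apply, smul_eq_mul, e11]
    linarith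
  · simp only [map_smul, smul_apply, smul_eq_mul, e21, mul_zero]
  · simp only [map_smul, smul_apply, h.normalField₂_x hz, h.normalField₂_y hz, smul_zero, and_self]
  · simp only [map_smul, smul_apply, h.normalField₁_x hz, h.normalField₁_y hz, smul_zero, and_self]
  · rw [j]
    exact mul_pos (mul_pos hr0 hr0)
      (mul_pos (h.realFactor_pos hreal hz) (pow_pos (h.confFactor_pos hz) 2))

end IsChernMinimalPatch

/-! ### The Gauss curvature of a conformal metric on the plane -/

theorem fderiv_smul_vector {W : Type*} [NormedAddCommGroup W] [NormedSpace ℝ W] {l : V → ℝ} {y : V}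
    (hl : DifferentiableAt ℝ l y) (w : W) :
    fderiv ℝ (fun y' => l y' • w) y = (fderiv ℝ l y).smulRight w :=
  (hl.hasFDerivAt.smul_const w).fderiv

/-- The Euclidean metric of `ℂ`. -/
def euclideanForm : ℂ →L[ℝ] ℂ →L[ℝ] ℝ :=
  Complex.reCLM.smulRight Complex.reCLM + Complex.imCLM.smulRight Complex.imCLM

theorem euclideanForm_apply (u v : ℂ) : euclideanForm u v = u.re * v.re + u.im * v.im := by
  simp [euclideanForm]

section Conformal

variable {G : ℂ → ℂ →L[ℝ] ℂ →L[ℝ] ℝ} {l : ℂ → ℝ} {O : Set ℂ}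

theorem conformal_pos {y : ℂ} (hl : 0 < l y) (hG : G y = l y • euclideanForm) (v : ℂ)
    (hv : v ≠ 0) : 0 < G y v v := by
  rw [hG]
  simp only [smul_apply, euclideanForm_apply, smul_eq_mul]
  refine mul_pos hl ?_
  have := Complex.normSq_pos.mpr hv
  rwa [Complex.normSq_apply] at this

/-- For `G = l |dz|²` the Levi-Civita form is `Γ(u, v) = ∂_z (log l) u v`. -/
theorem leviCivita_conformal (hO : IsOpen O) (hl : ∀ y ∈ O, 0 < l y) (hd : ContDiffOn ℝ ∞ l O)
    (hG : ∀ y ∈ O, G y = l y • euclideanForm) {y : ℂ} (hy : y ∈ O) (u v : ℂ) :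
    leviCivita G y u v = ((1 / 2 : ℝ) • (fderiv ℝ (fun y' => Real.log (l y')) y 1
      - Complex.I * fderiv ℝ (fun y' => Real.log (l y')) y Complex.I)) * u * v := by
  have hly := (hl y hy).ne'
  have hdy : DifferentiableAt ℝ l y :=
    (hd.contDiffAt (hO.mem_nhds hy)).differentiableAt (by simp)
  have hGy : fderiv ℝ G y = (fderiv ℝ l y).smulRight euclideanForm := by
    have e : G =ᶠ[𝓝 y] fun y' => l y' • euclideanForm := by
      filter_upwards [hO.mem_nhds hy] with y' hy' using hG y' hy'
    rw [e.fderiv_eq]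
    exact fderiv_smul_vector hdy euclideanForm
  have hlog (w : ℂ) : fderiv ℝ (fun y' => Real.log (l y')) y w = fderiv ℝ l y w / l y := by
    rw [(hdy.hasFDerivAt.log hly).fderiv]
    simp
    ring
  have hpos := conformal_pos (hl y hy) (hG y hy)
  have hlin (w : ℂ) : fderiv ℝ l y w = w.re * fderiv ℝ l y 1 + w.im * fderiv ℝ l y Complex.I := by
    conv_lhs => rw [← Complex.re_add_im w, show (w.re : ℂ) + w.im * Complex.I =
      w.re • (1 : ℂ) + w.im • Complex.I by simp, map_add, map_smul, map_smul]
    rfl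
  have key (w : ℂ) := leviCivita_pairing hpos u v w
  simp only [hGy, hG y hy, smul_apply, ContinuousLinearMap.smulRight_apply, euclideanForm_apply,
    smul_eq_mul] at key
  have k1 := key 1
  have k2 := key Complex.I
  rw [hlin u, hlin v] at k1 k2
  simp only [Complex.one_re, Complex.one_im, Complex.I_re, Complex.I_im] at k1 k2
  simp only [hlog]
  clear hlog hlin hGy key
  generalize leviCivita G y u v = X at *
  generalize fderiv ℝ l y 1 = p at *
  generalize fderiv ℝ l y Complex.I = q at *
  generalize l y = r at *
  apply Complex.ext
  · simp only [Complex.mul_re, Complex.mul_im, Complex.smul_re, Complex.smul_im,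
      Complex.sub_re, Complex.sub_im, Complex.ofReal_re, Complex.ofReal_im, Complex.I_re,
      Complex.I_im, smul_eq_mul]
    apply mul_left_cancel₀ hly
    field_simp
    linarith
  · simp only [Complex.mul_re, Complex.mul_im, Complex.smul_re, Complex.smul_im,
      Complex.sub_re, Complex.sub_im, Complex.ofReal_re, Complex.ofReal_im, Complex.I_re,
      Complex.I_im, smul_eq_mul]
    apply mul_left_cancel₀ hly
    field_simp
    linarith

/-- The Gauss curvature of `l |dz|²` is `-Δ (log l) / (2 l)`. -/
theorem sectionalCurvature_conformal (hO : IsOpen O) (hl : ∀ y ∈ O, 0 < l y)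
    (hd : ContDiffOn ℝ ∞ l O) (hG : ∀ y ∈ O, G y = l y • euclideanForm) {y : ℂ} (hy : y ∈ O) :
    sectionalCurvature G y 1 Complex.I =
      -Laplacian.laplacian (fun y' => Real.log (l y')) y / (2 * l y) := by
  have hly := (hl y hy).ne'
  set s : ℂ → ℝ := fun y' => Real.log (l y')
  have hcs : ContDiffAt ℝ ∞ s y := (hd.contDiffAt (hO.mem_nhds hy)).log hly
  have hds (u : ℂ) : HasFDerivAt (fun y' => fderiv ℝ s y' u)
      (fderiv ℝ (fun y' => fderiv ℝ s y' u) y) y :=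
    (((hcs.fderiv_right (m := ∞) (by simp)).clm_apply
      contDiffAt_const).differentiableAt (by simp)).hasFDerivAt
  have hfd (c w : ℂ) : fderiv ℝ (fun y' => ((1 / 2 : ℝ) • (fderiv ℝ s y' 1
      - Complex.I * fderiv ℝ s y' Complex.I : ℂ)) * c) y w =
      ((1 / 2 : ℝ) • (fderiv ℝ (fun y' => fderiv ℝ s y' 1) y w
      - Complex.I * fderiv ℝ (fun y' => fderiv ℝ s y' Complex.I) y w : ℂ)) * c := by
    have h1 := Complex.ofRealCLM.hasFDerivAt.comp y (hds 1)
    have h2 := (Complex.ofRealCLM.hasFDerivAt.comp y (hds Complex.I)).const_mul Complex.I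
    have h3 := ((h1.sub h2).const_smul (1 / 2 : ℝ)).mul_const c
    have h4 : fderiv ℝ (fun y' => ((1 / 2 : ℝ) • (fderiv ℝ s y' 1
      - Complex.I * fderiv ℝ s y' Complex.I : ℂ)) * c) y = _ := h3.fderiv
    rw [h4]
    simp
    ring
  have hL (u v : ℂ) : (fun y' => leviCivita G y' u v) =ᶠ[𝓝 y] fun y' =>
      ((1 / 2 : ℝ) • (fderiv ℝ s y' 1 - Complex.I * fderiv ℝ s y' Complex.I : ℂ)) * (u * v) := by
    filter_upwards [hO.mem_nhds hy] with y' hy'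
    rw [leviCivita_conformal hO hl hd hG hy', mul_assoc]
  have hR : riemannCurvature G y 1 Complex.I Complex.I =
      ((-(1 / 2) * Laplacian.laplacian s y : ℝ) : ℂ) := by
    have hsymm : fderiv ℝ (fun y' => fderiv ℝ s y' Complex.I) y 1 =
        fderiv ℝ (fun y' => fderiv ℝ s y' 1) y Complex.I := by
      have hd : DifferentiableAt ℝ (fderiv ℝ s) y :=
        (hcs.fderiv_right (m := ∞) (by simp)).differentiableAt (by simp)
      have hs : IsSymmSndFDerivAt ℝ s y := hcs.isSymmSndFDerivAt
        (by simpa using ENat.LEInfty.out)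
      rw [fderiv_clm_apply hd (by fun_prop), fderiv_clm_apply hd (by fun_prop)]
      simpa using hs.eq 1 Complex.I
    rw [riemannCurvature, (hL _ _).fderiv_eq, (hL _ _).fderiv_eq, hfd, hfd,
      laplacian_eq (hcs.of_le ENat.LEInfty.out)]
    simp only [leviCivita_conformal hO hl hd hG hy, hsymm]
    apply Complex.ext
    · simp
      ring
    · simp
      ring
  rw [sectionalCurvature, hR, hG y hy]
  simp only [smul_apply, euclideanForm_apply, smul_eq_mul]
  simp
  field_simp

end Conformal

/-! ### Harmonic functions -/

/-- The strong maximum principle for harmonic functions of two variables. -/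
theorem eventually_eq_of_isLocalMax_harmonic {u : ℂ → ℝ} {z : ℂ}
    (hu : InnerProductSpace.HarmonicAt u z) (hmax : IsLocalMax u z) :
    ∀ᶠ w in 𝓝 z, u w = u z := by
  obtain ⟨r, hr, hball⟩ := Metric.isOpen_iff.mp
    (InnerProductSpace.isOpen_setOfPred_harmonicAt (f := u)) z hu
  obtain ⟨H, hH, hre⟩ := InnerProductSpace.HarmonicOnNhd.exists_analyticOnNhd_ball_re_eq
    (fun _ hy => hball hy)
  have hmem : Metric.ball z r ∈ 𝓝 z := Metric.ball_mem_nhds z hr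
  have hnorm : ∀ w ∈ Metric.ball z r, ‖Complex.exp (H w)‖ = Real.exp (u w) := fun w hw => by
    rw [Complex.norm_exp, ← hre hw]
  have hz := Metric.mem_ball_self hr (x := z)
  have h1 : ∀ᶠ w in 𝓝 z, DifferentiableAt ℂ (fun w => Complex.exp (H w)) w := by
    filter_upwards [hmem] with w hw using (hH w hw).differentiableAt.cexp
  have h2 : IsLocalMax (norm ∘ fun w => Complex.exp (H w)) z := by
    filter_upwards [hmem, hmax] with w hw hle
    simp only [Function.comp, hnorm w hw, hnorm z hz]
    exact Real.exp_le_exp.mpr hle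
  filter_upwards [Complex.eventually_eq_of_isLocalMax_norm h1 h2, hmem] with w hw hw'
  have := congrArg norm hw
  rw [hnorm w hw', hnorm z hz] at this
  exact Real.exp_injective this

/-- The Laplacian of the composition with a holomorphic map `φ` is `|φ'|² (Δ u) ∘ φ`; only the
vanishing at corresponding points is recorded. -/
theorem laplacian_comp_eq_zero {u : ℂ → ℝ} {φ : ℂ → ℂ} {z : ℂ} (hφ : AnalyticAt ℂ φ z)
    (hu : ContDiffAt ℝ 2 u (φ z)) (h0 : Laplacian.laplacian u (φ z) = 0) :
    Laplacian.laplacian (u ∘ φ) z = 0 := by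
  have hφr : ContDiffAt ℝ 2 φ z := (hφ.contDiffAt (n := 2)).restrict_scalars ℝ
  have huφ : ContDiffAt ℝ 2 (u ∘ φ) z := hu.comp z hφr
  have hder : ∀ᶠ w in 𝓝 z, ∀ v, fderiv ℝ (u ∘ φ) w v = fderiv ℝ u (φ w) (deriv φ w * v) := by
    have hu1 : ∀ᶠ y in 𝓝 (φ z), DifferentiableAt ℝ u y := by
      filter_upwards [hu.eventually (by simp)] with y hy using hy.differentiableAt (by simp)
    filter_upwards [hφ.continuousAt.eventually hu1, hφ.eventually_analyticAt] with w h1 h2 v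
    have h3 : HasFDerivAt φ ((fderiv ℂ φ w).restrictScalars ℝ) w :=
      h2.differentiableAt.hasFDerivAt.restrictScalars ℝ
    rw [(h1.hasFDerivAt.comp w h3).fderiv]
    simp [mul_comm]
  have hd2 : DifferentiableAt ℝ (fderiv ℝ u) (φ z) :=
    (hu.fderiv_right (m := 1) (by norm_num)).differentiableAt (by simp)
  have hφd : HasFDerivAt φ ((fderiv ℂ φ z).restrictScalars ℝ) z :=
    hφ.differentiableAt.hasFDerivAt.restrictScalars ℝ
  have hφd2 : HasFDerivAt (deriv φ) ((fderiv ℂ (deriv φ) z).restrictScalars ℝ) z :=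
    hφ.deriv.differentiableAt.hasFDerivAt.restrictScalars ℝ
  have hsnd (v : ℂ) : fderiv ℝ (fun w => fderiv ℝ (u ∘ φ) w v) z v =
      fderiv ℝ (fderiv ℝ u) (φ z) (deriv φ z * v) (deriv φ z * v)
        + fderiv ℝ u (φ z) (deriv (deriv φ) z * (v * v)) := by
    have e : (fun w => fderiv ℝ (u ∘ φ) w v) =ᶠ[𝓝 z]
        fun w => fderiv ℝ u (φ w) (deriv φ w * v) := hder.mono fun w hw => hw v
    rw [e.fderiv_eq]
    have h1 := (HasFDerivAt.comp z hd2.hasFDerivAt hφd).clm_apply (hφd2.mul_const v)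
    have h2 : fderiv ℝ (fun w => fderiv ℝ u (φ w) (deriv φ w * v)) z = _ := h1.fderiv
    rw [h2]
    simp only [add_apply, ContinuousLinearMap.comp_apply, ContinuousLinearMap.flip_apply,
      ContinuousLinearMap.coe_restrictScalars', fderiv_eq_smul_deriv, smul_apply, smul_eq_mul,
      Function.comp_apply]
    rw [add_comm, mul_comm v (deriv φ z)]
    congr 2
    ring
  have hB (c : ℂ) : fderiv ℝ (fderiv ℝ u) (φ z) c c
      + fderiv ℝ (fderiv ℝ u) (φ z) (c * Complex.I) (c * Complex.I) =
      (c.re ^ 2 + c.im ^ 2) * Laplacian.laplacian u (φ z) := by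
    have hsy := (hu.isSymmSndFDerivAt (by simp)).eq 1 Complex.I
    have e1 : c = c.re • (1 : ℂ) + c.im • Complex.I := by
      simp [Complex.re_add_im]
    have e2 : c * Complex.I = (-c.im) • (1 : ℂ) + c.re • Complex.I := by
      apply Complex.ext <;> simp
    rw [laplacian_eq hu, fderiv_clm_apply hd2 (by fun_prop), fderiv_clm_apply hd2 (by fun_prop), e2]
    conv_lhs => enter [1]; rw [e1]
    simp only [map_add, map_smul, add_apply, smul_apply, smul_eq_mul]
    simp
    rw [hsy]
    ring
  rw [laplacian_eq huφ, hsnd, hsnd]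
  have h3 := hB (deriv φ z)
  rw [h0, mul_zero] at h3
  simp only [mul_one, Complex.I_mul_I, mul_neg, map_neg]
  linarith

/-! ### Charts of complex manifolds -/

section Charts

variable {M : Type*} [TopologicalSpace M] [ChartedSpace E M]
  {E' : Type*} [NormedAddCommGroup E'] [NormedSpace ℂ E']
  {M' : Type*} [TopologicalSpace M'] [ChartedSpace E' M']

/-- The real differential of a holomorphic map is its complex differential. -/
theorem mfderiv_real_eq {h : M → M'} {p : M} (hh : MDifferentiableAt 𝓘(ℂ, E) 𝓘(ℂ, E') h p) :
    HasMFDerivAt 𝓘(ℝ, E) 𝓘(ℝ, E') h p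
      ((show E →L[ℂ] E' from mfderiv 𝓘(ℂ, E) 𝓘(ℂ, E') h p).restrictScalars ℝ) := by
  have h1 := hh.hasMFDerivAt
  exact ⟨h1.1, h1.2.restrictScalars ℝ⟩

theorem mfderiv_mulI {h : M → M'} {p : M} (hh : MDifferentiableAt 𝓘(ℂ, E) 𝓘(ℂ, E') h p) (v : E) :
    (mfderiv 𝓘(ℝ, E) 𝓘(ℝ, E') h p : E →L[ℝ] E') (mulI E v) =
      mulI E' ((mfderiv 𝓘(ℝ, E) 𝓘(ℝ, E') h p : E →L[ℝ] E') v) := by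
  rw [(mfderiv_real_eq hh).mfderiv]
  exact map_smul (show E →L[ℂ] E' from mfderiv 𝓘(ℂ, E) 𝓘(ℂ, E') h p) Complex.I v

theorem mdifferentiableAt_chart_symm [IsManifold 𝓘(ℂ, E) ω M] {e : OpenPartialHomeomorph M E}
    (he : e ∈ atlas E M) {y : E} (hy : y ∈ e.target) :
    MDifferentiableAt 𝓘(ℂ, E) 𝓘(ℂ, E) e.symm y :=
  ((contMDiffOn_symm_of_mem_maximalAtlas (I := 𝓘(ℂ, E)) (n := ω)
    (IsManifold.subset_maximalAtlas he)).contMDiffAt (e.open_target.mem_nhds hy)).mdifferentiableAt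
    (by simp)

theorem mfderiv_chart_symm_injective [IsManifold 𝓘(ℂ, E) ω M] {e : OpenPartialHomeomorph M E}
    (he : e ∈ atlas E M) {y : E} (hy : y ∈ e.target) :
    Function.Injective (mfderiv 𝓘(ℝ, E) 𝓘(ℝ, E) e.symm y) := by
  have h1 : MDifferentiableAt 𝓘(ℝ, E) 𝓘(ℝ, E) e.symm y :=
    (mfderiv_real_eq (mdifferentiableAt_chart_symm he hy)).mdifferentiableAt
  have h2 : MDifferentiableAt 𝓘(ℝ, E) 𝓘(ℝ, E) e (e.symm y) :=
    ((contMDiffOn_of_mem_maximalAtlas (I := 𝓘(ℝ, E)) (n := ∞)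
      (IsManifold.subset_maximalAtlas he)).contMDiffAt
      (e.open_source.mem_nhds (e.map_target hy))).mdifferentiableAt (by simp)
  have h3 := mfderiv_comp y h2 h1
  have h4 : (e ∘ e.symm) =ᶠ[𝓝 y] id := by
    filter_upwards [e.open_target.mem_nhds hy] with w hw using e.right_inv hw
  rw [h4.mfderiv_eq, mfderiv_id] at h3
  intro v w hvw
  have h5 := congrArg (mfderiv 𝓘(ℝ, E) 𝓘(ℝ, E) e (e.symm y)) hvw
  rw [← ContinuousLinearMap.comp_apply, ← ContinuousLinearMap.comp_apply] at h5
  have h6 : ∀ v : E, (mfderiv 𝓘(ℝ, E) 𝓘(ℝ, E) e (e.symm y)).comp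
      (mfderiv 𝓘(ℝ, E) 𝓘(ℝ, E) e.symm y) v = v := fun v => by rw [← h3]; rfl
  exact (h6 v).symm.trans (h5.trans (h6 w))

end Charts

/-! ### Coordinate expressions of metrics -/

section Pullback

variable {M : Type*} [TopologicalSpace M] [ChartedSpace E M] [IsManifold 𝓘(ℂ, E) ω M]

theorem pullbackMetric_apply (g : HermitianMetric E M) (h : V → M) (y u v : V) :
    pullbackMetric g h y u v = g.inner (h y) (mfderiv 𝓘(ℝ, V) 𝓘(ℝ, E) h y u)
      (mfderiv 𝓘(ℝ, V) 𝓘(ℝ, E) h y v) := rfl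

theorem pullbackMetric_congr (g : HermitianMetric E M) {h h' : V → M} {y : V}
    (hh : h =ᶠ[𝓝 y] h') : pullbackMetric g h y = pullbackMetric g h' y := by
  let T : V →L[ℝ] E := mfderiv 𝓘(ℝ, V) 𝓘(ℝ, E) h y
  let T' : V →L[ℝ] E := mfderiv 𝓘(ℝ, V) 𝓘(ℝ, E) h' y
  have h1 : T = T' := hh.mfderiv_eq
  let gE : M → E →L[ℝ] E →L[ℝ] ℝ := fun p => g.inner p
  have h2 : gE (h y) = gE (h' y) := by rw [hh.eq_of_nhds]
  ext u v
  change gE (h y) (T u) (T v) = gE (h' y) (T' u) (T' v)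
  rw [h1, h2]

/-- Functoriality of the pullback for a change of parameter between vector spaces. -/
theorem pullbackMetric_comp {W : Type*} [NormedAddCommGroup W] [NormedSpace ℝ W]
    (g : HermitianMetric E M) {h : W → M} {k : V → W} {y : V}
    (hh : MDifferentiableAt 𝓘(ℝ, W) 𝓘(ℝ, E) h (k y)) (hk : DifferentiableAt ℝ k y) (u v : V) :
    pullbackMetric g (h ∘ k) y u v =
      pullbackMetric g h (k y) (fderiv ℝ k y u) (fderiv ℝ k y v) := by
  have h1 : (mfderiv 𝓘(ℝ, V) 𝓘(ℝ, W) k y : V →L[ℝ] W) = fderiv ℝ k y := mfderiv_eq_fderiv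
  rw [pullbackMetric_apply, pullbackMetric_apply, mfderiv_comp y hh hk.mdifferentiableAt, h1]
  rfl

theorem contDiffOn_pullbackMetric [FiniteDimensional ℝ V] (g : HermitianMetric E M) {h : V → M}
    {O : Set V} (hO : IsOpen O) (hh : ContMDiffOn 𝓘(ℝ, V) 𝓘(ℝ, E) ∞ h O) :
    ContDiffOn ℝ ∞ (pullbackMetric g h) O := by
  rw [contDiffOn_clm_apply]
  intro v
  rw [contDiffOn_clm_apply]
  intro w
  have hsec (v : V) : ContMDiffOn 𝓘(ℝ, V) 𝓘(ℝ, E).tangent ∞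
      (fun y => (⟨h y, mfderiv 𝓘(ℝ, V) 𝓘(ℝ, E) h y v⟩ : TangentBundle 𝓘(ℝ, E) M)) O := by
    have h1 := hh.contMDiffOn_tangentMapWithin (m := ∞) (by simp) hO.uniqueMDiffOn
    have h2 : ContMDiffOn 𝓘(ℝ, V) 𝓘(ℝ, V).tangent ∞
        (fun y => (⟨y, v⟩ : TangentBundle 𝓘(ℝ, V) V)) O := by
      exact (contMDiffOn_vectorSpace_iff_contDiffOn (V := fun _ => v)).mpr contDiffOn_const
    refine (h1.comp h2 fun y hy => hy).congr fun y hy => ?_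
    simp only [Function.comp, tangentMapWithin, mfderivWithin_of_isOpen hO hy]
  rw [← contMDiffOn_iff_contDiffOn]
  intro y hy
  have h3 : ContMDiffWithinAt 𝓘(ℝ, V) (𝓘(ℝ, E).prod 𝓘(ℝ)) ∞
      (fun m => TotalSpace.mk' ℝ (E := Bundle.Trivial M ℝ) (h m)
        (g.inner (h m) (mfderiv 𝓘(ℝ, V) 𝓘(ℝ, E) h m v) (mfderiv 𝓘(ℝ, V) 𝓘(ℝ, E) h m w))) O y := by
    apply ContMDiffWithinAt.clm_bundle_apply₂ (F₁ := E) (F₂ := E)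
    · exact ContMDiffAt.comp_contMDiffWithinAt y g.contMDiff.contMDiffAt (hh y hy)
    · exact hsec v y hy
    · exact hsec w y hy
  simp only [contMDiffWithinAt_totalSpace] at h3
  exact h3.2

theorem isHermitianOn_pullbackMetric [FiniteDimensional ℝ E] (g : HermitianMetric E M)
    {e : OpenPartialHomeomorph M E} (he : e ∈ atlas E M) :
    IsHermitianOn (pullbackMetric g e.symm) e.target where
  isOpen := e.open_target
  smooth := contDiffOn_pullbackMetric g e.open_target
    (contMDiffOn_symm_of_mem_maximalAtlas (IsManifold.subset_maximalAtlas he))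
  symm y _ v w := by
    rw [pullbackMetric_apply, pullbackMetric_apply]
    exact g.symm _ _ _
  mulI y hy v w := by
    have h1 := mdifferentiableAt_chart_symm he hy
    have h2 := g.inner_complexStructure (e.symm y) (mfderiv 𝓘(ℝ, E) 𝓘(ℝ, E) e.symm y v)
      (mfderiv 𝓘(ℝ, E) 𝓘(ℝ, E) e.symm y w)
    rw [pullbackMetric_apply, pullbackMetric_apply, ← h2]
    exact congrArg₂ (fun a b : E => g.inner (e.symm y) a b) (mfderiv_mulI h1 v) (mfderiv_mulI h1 w)
  pos y hy v hv := by
    rw [pullbackMetric_apply]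
    refine g.pos _ _ fun h0 => hv ?_
    exact mfderiv_chart_symm_injective he hy (h0.trans (map_zero _).symm)

end Pullback

/-! ### Immersed surfaces in charts -/

section Surface

variable {M : Type*} [TopologicalSpace M] [ChartedSpace E M] [IsManifold 𝓘(ℂ, E) ω M]
  {S : Type*} [TopologicalSpace S] [ChartedSpace ℂ S]

/-- The cosine `⟨J df(e), df(j e)⟩` of the Kähler angle. -/
def cosAngle (g : HermitianMetric E M) (f : S → M) (x : S) : ℝ :=
  let a : TangentSpace 𝓘(ℝ, E) (f x) := differential f x (1 : ℂ)
  let b : TangentSpace 𝓘(ℝ, E) (f x) := differential f x (Complex.I : ℂ)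
  g.inner (f x) (complexStructure E (f x) a) b / g.inner (f x) a a

theorem kahlerAngle_eq (g : HermitianMetric E M) (f : S → M) (x : S) :
    kahlerAngle g f x = Real.arccos (cosAngle g f x) := rfl

section Pointwise

/-! At a point, the differential of a conformal immersion is a linear map `L : ℂ → E`, conformal
for a Hermitian inner product `B`. -/

variable {B : E →L[ℝ] E →L[ℝ] ℝ} {L : ℂ →L[ℝ] E}

theorem clm_apply_complex (L : ℂ →L[ℝ] E) (k : ℂ) : L k = k.re • L 1 + k.im • L Complex.I := by
  conv_lhs => rw [show k = k.re • (1 : ℂ) + k.im • Complex.I by simp [Complex.re_add_im], map_add,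
    map_smul, map_smul]

variable (hsymm : ∀ v w, B v w = B w v) (hJ : ∀ v w, B (mulI E v) (mulI E w) = B v w)
  (hL : ∀ u v, B (L (Complex.I * u)) (L (Complex.I * v)) = B (L u) (L v))

include hL in
theorem conformal_norm_eq : B (L Complex.I) (L Complex.I) = B (L 1) (L 1) := by
  simpa using hL 1 1

include hL hsymm in
theorem conformal_orth : B (L 1) (L Complex.I) = 0 := by
  have h1 := hL 1 Complex.I
  rw [Complex.I_mul_I, mul_one, map_neg, map_neg, hsymm] at h1
  linarith

include hL hsymm in
theorem conformal_apply (u v : ℂ) : B (L u) (L v) = B (L 1) (L 1) * euclideanForm u v := by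
  have h1 := conformal_norm_eq hL
  have h2 := conformal_orth hsymm hL
  have h3 := (hsymm _ _).trans h2
  rw [clm_apply_complex L u, clm_apply_complex L v]
  simp only [map_add, map_smul, add_apply, smul_apply, smul_eq_mul, h1, h2, h3,
    euclideanForm_apply]
  ring

include hsymm hJ in
theorem kahlerForm_apply (k : ℂ) : B (mulI E (L k)) (L (Complex.I * k)) =
    (k.re ^ 2 + k.im ^ 2) * B (mulI E (L 1)) (L Complex.I) := by
  have hl (v w : E) : B (mulI E v) w = -B v (mulI E w) := by
    rw [← hJ v, mulI_mulI]; simp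
  have h0 (v : E) : B (mulI E v) v = 0 := by
    have h1 := hl v v
    rw [hsymm v] at h1
    linarith
  have h1 : B (mulI E (L Complex.I)) (L 1) = -B (mulI E (L 1)) (L Complex.I) := by
    rw [hl, hsymm]
  rw [clm_apply_complex L k, clm_apply_complex L (Complex.I * k)]
  simp only [map_add, map_smul, add_apply, smul_apply, smul_eq_mul, h0, h1, Complex.mul_re,
    Complex.mul_im, Complex.I_re, Complex.I_im]
  ring

variable (hpos : ∀ v, v ≠ 0 → 0 < B v v)

include hsymm hJ hL hpos in
theorem complex_iff_of_conformal (ε : ℝ) (hε : ε ^ 2 = 1) :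
    (∀ v, L (Complex.I * v) = ε • mulI E (L v)) ↔
      ε * B (mulI E (L 1)) (L Complex.I) = B (L 1) (L 1) := by
  have h1 := conformal_norm_eq hL
  constructor
  · intro h
    have h2 := h 1
    rw [mul_one] at h2
    rw [h2, map_smul, hJ, smul_eq_mul, ← mul_assoc, ← sq, hε, one_mul]
  · intro h
    have h2 : L Complex.I = ε • mulI E (L 1) := by
      rw [← sub_eq_zero]
      by_contra hne
      have h3 := hpos _ hne
      simp only [map_sub, map_smul, sub_apply, smul_apply, smul_eq_mul, hJ, h1,
        hsymm (L Complex.I)] at h3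
      exact h3.ne (by linear_combination 2 * h - B (L 1) (L 1) * hε)
    intro v
    rw [clm_apply_complex L v, clm_apply_complex L (Complex.I * v), h2]
    simp only [map_add, map_smul, mulI_mulI, smul_add, Complex.mul_re, Complex.mul_im,
      Complex.I_re, Complex.I_im, smul_smul, smul_neg]
    rw [show ε * (v.im * ε) = v.im by linear_combination v.im * hε]
    module

include hsymm hJ hL in
theorem abs_kahlerForm_le (hpos' : ∀ v, 0 ≤ B v v) :
    |B (mulI E (L 1)) (L Complex.I)| ≤ B (L 1) (L 1) := by
  have h1 := conformal_norm_eq hL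
  have h2 := hpos' (mulI E (L 1) - L Complex.I)
  have h3 := hpos' (mulI E (L 1) + L Complex.I)
  simp only [map_sub, map_add, sub_apply, add_apply, hJ, h1, hsymm (L Complex.I)] at h2 h3
  rw [abs_le]
  constructor <;> linarith

end Pointwise

/-- The inner product of `T_p M`, on the model space. -/
def innerAt (g : HermitianMetric E M) (p : M) : E →L[ℝ] E →L[ℝ] ℝ := g.inner p

/-- The differential of `f`, as a map of the model spaces. -/
def differentialAt (E : Type*) [NormedAddCommGroup E] [NormedSpace ℂ E] {M : Type*}
    [TopologicalSpace M] [ChartedSpace E M] (f : S → M) (x : S) : ℂ →L[ℝ] E :=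
  differential (E := E) f x

theorem innerAt_pos (g : HermitianMetric E M) (p : M) (v : E) (hv : v ≠ 0) : 0 < innerAt g p v v :=
  g.pos p v hv

theorem innerAt_nonneg (g : HermitianMetric E M) (p : M) (v : E) : 0 ≤ innerAt g p v v := by
  by_cases hv : v = 0
  · rw [hv, map_zero]
  · exact (innerAt_pos g p v hv).le

theorem innerAt_symm (g : HermitianMetric E M) (p : M) (v w : E) :
    innerAt g p v w = innerAt g p w v := g.symm p v w

theorem innerAt_mulI (g : HermitianMetric E M) (p : M) (v w : E) :
    innerAt g p (mulI E v) (mulI E w) = innerAt g p v w := g.inner_complexStructure p v w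

theorem cosAngle_eq (g : HermitianMetric E M) (f : S → M) (x : S) :
    cosAngle g f x = innerAt g (f x) (mulI E (differentialAt E f x 1))
      (differentialAt E f x Complex.I) /
        innerAt g (f x) (differentialAt E f x 1) (differentialAt E f x 1) := rfl

variable {g : HermitianMetric E M} {f : S → M} (hf : IsConformalImmersion g f)
include hf

theorem differentialAt_conformal (x : S) (u v : ℂ) :
    innerAt g (f x) (differentialAt E f x (Complex.I * u)) (differentialAt E f x (Complex.I * v)) =
      innerAt g (f x) (differentialAt E f x u) (differentialAt E f x v) :=
  hf.conformal x u v

theorem differentialAt_ne_zero (x : S) {k : ℂ} (hk : k ≠ 0) : differentialAt E f x k ≠ 0 :=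
  fun h => hk (hf.immersion x (h.trans (map_zero (differentialAt E f x)).symm))

theorem innerAt_differentialAt_pos (x : S) :
    0 < innerAt g (f x) (differentialAt E f x 1) (differentialAt E f x 1) :=
  innerAt_pos g _ _ (differentialAt_ne_zero hf x one_ne_zero)

theorem abs_cosAngle_le_one (x : S) : |cosAngle g f x| ≤ 1 := by
  have h0 := innerAt_differentialAt_pos hf x
  have h1 := abs_kahlerForm_le (innerAt_symm g (f x)) (innerAt_mulI g _)
    (differentialAt_conformal hf x) (innerAt_nonneg g _)
  rw [cosAngle_eq, abs_div, abs_of_pos h0]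
  exact div_le_one_of_le₀ h1 h0.le

theorem isComplexPoint_iff (x : S) : IsComplexPoint E f x ↔ cosAngle g f x = 1 := by
  have h0 := innerAt_differentialAt_pos hf x
  have h1 := complex_iff_of_conformal (innerAt_symm g (f x)) (innerAt_mulI g _)
    (differentialAt_conformal hf x) (innerAt_pos g _) 1 (by norm_num)
  rw [one_mul] at h1
  rw [cosAngle_eq, div_eq_one_iff_eq h0.ne', ← h1]
  simp only [one_smul]
  rfl

theorem isAnticomplexPoint_iff (x : S) : IsAnticomplexPoint E f x ↔ cosAngle g f x = -1 := by
  have h0 := innerAt_differentialAt_pos hf x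
  have h1 := complex_iff_of_conformal (innerAt_symm g (f x)) (innerAt_mulI g _)
    (differentialAt_conformal hf x) (innerAt_pos g _) (-1) (by norm_num)
  rw [neg_one_mul, neg_eq_iff_eq_neg] at h1
  rw [cosAngle_eq, div_eq_iff h0.ne', neg_one_mul, ← h1]
  simp only [neg_one_smul]
  rfl

theorem isRealPoint_iff (x : S) : IsRealPoint E f x ↔ cosAngle g f x ^ 2 < 1 := by
  rw [IsRealPoint, isComplexPoint_iff hf, isAnticomplexPoint_iff hf]
  have h1 := abs_cosAngle_le_one hf x
  rw [sq_lt_one_iff_abs_lt_one, lt_iff_le_and_ne, and_iff_right h1, ne_eq,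
    abs_eq zero_le_one, not_or]

end Surface

/-! ### Chern minimal surfaces in charts -/

section SurfaceCharts

variable {M : Type*} [TopologicalSpace M] [ChartedSpace E M] [IsManifold 𝓘(ℂ, E) ω M]
  {S : Type*} [TopologicalSpace S] [ChartedSpace ℂ S] [IsManifold 𝓘(ℂ, ℂ) ω S]

/-- The coordinate expression of `f` in the charts `e` and `e'`. -/
def coordMap (f : S → M) (e : OpenPartialHomeomorph S ℂ) (e' : OpenPartialHomeomorph M E) : ℂ → E :=
  e' ∘ f ∘ e.symm

/-- The domain of the coordinate expression of `f` in the charts `e` and `e'`. -/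
def coordDomain (f : S → M) (e : OpenPartialHomeomorph S ℂ) (e' : OpenPartialHomeomorph M E) :
    Set ℂ :=
  e.target ∩ (f ∘ e.symm) ⁻¹' e'.source

variable {g : HermitianMetric E M} {f : S → M} (hf : IsConformalImmersion g f)
  {e : OpenPartialHomeomorph S ℂ} (he : e ∈ atlas ℂ S)
  {e' : OpenPartialHomeomorph M E} (he' : e' ∈ atlas E M)

include hf he in
theorem contMDiffOn_comp_chart_symm : ContMDiffOn 𝓘(ℝ, ℂ) 𝓘(ℝ, E) ∞ (f ∘ e.symm) e.target :=
  hf.smooth.comp_contMDiffOn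
    (contMDiffOn_symm_of_mem_maximalAtlas (IsManifold.subset_maximalAtlas he))

include hf he in
theorem isOpen_coordDomain : IsOpen (coordDomain f e e') :=
  (contMDiffOn_comp_chart_symm hf he).continuousOn.isOpen_inter_preimage e.open_target
    e'.open_source

include hf he he' in
theorem contDiffOn_coordMap : ContDiffOn ℝ ∞ (coordMap f e e') (coordDomain f e e') := by
  rw [← contMDiffOn_iff_contDiffOn]
  exact (contMDiffOn_of_mem_maximalAtlas (IsManifold.subset_maximalAtlas he')).comp
    ((contMDiffOn_comp_chart_symm hf he).mono inter_subset_left) fun z hz => hz.2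

omit [NormedSpace ℂ E] [ChartedSpace E M] [IsManifold 𝓘(ℂ, E) ω M] [ChartedSpace ℂ S]
  [IsManifold 𝓘(ℂ, ℂ) ω S] in
theorem mapsTo_coordMap : MapsTo (coordMap f e e') (coordDomain f e e') e'.target :=
  fun _ hz => e'.map_source hz.2

include hf he he' in
theorem pullbackMetric_eq_coord {z : ℂ} (hz : z ∈ coordDomain f e e') (u v : ℂ) :
    pullbackMetric g (f ∘ e.symm) z u v = pullbackMetric g e'.symm (coordMap f e e' z)
      (fderiv ℝ (coordMap f e e') z u) (fderiv ℝ (coordMap f e e') z v) := by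
  have h1 : f ∘ e.symm =ᶠ[𝓝 z] e'.symm ∘ coordMap f e e' := by
    filter_upwards [(isOpen_coordDomain hf he).mem_nhds hz] with w hw
    exact (e'.left_inv hw.2).symm
  rw [pullbackMetric_congr g h1]
  exact pullbackMetric_comp g
    (mfderiv_real_eq (mdifferentiableAt_chart_symm he' (mapsTo_coordMap hz))).mdifferentiableAt
    (((contDiffOn_coordMap hf he he').contDiffAt
      ((isOpen_coordDomain hf he).mem_nhds hz)).differentiableAt (by simp)) u v

include he in
/-- The differential of the inverse of a holomorphic chart is a complex multiplication. -/
theorem exists_mfderiv_chart_symm {z : ℂ} (hz : z ∈ e.target) :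
    ∃ k : ℂ, k ≠ 0 ∧ ∀ u : ℂ, (mfderiv 𝓘(ℝ, ℂ) 𝓘(ℝ, ℂ) e.symm z : ℂ →L[ℝ] ℂ) u = k * u := by
  have h1 := mfderiv_mulI (mdifferentiableAt_chart_symm he hz) 1
  have h2 := mfderiv_chart_symm_injective he hz
  set T : ℂ →L[ℝ] ℂ := mfderiv 𝓘(ℝ, ℂ) 𝓘(ℝ, ℂ) e.symm z
  have h3 : T Complex.I = Complex.I * T 1 := by
    have h4 : T (mulI ℂ 1) = mulI ℂ (T 1) := h1
    rwa [mulI_apply, mulI_apply, smul_eq_mul, smul_eq_mul, mul_one] at h4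
  refine ⟨T 1, fun h0 => one_ne_zero (α := ℂ) (h2 (h0.trans (map_zero T).symm)), fun u => ?_⟩
  change T u = T 1 * u
  rw [clm_apply_complex T u, h3]
  conv_rhs => rw [← Complex.re_add_im u]
  simp only [Complex.real_smul]
  ring

include hf he in
theorem mfderiv_comp_chart_symm {z : ℂ} (hz : z ∈ e.target) (u : ℂ) :
    (mfderiv 𝓘(ℝ, ℂ) 𝓘(ℝ, E) (f ∘ e.symm) z : ℂ →L[ℝ] E) u =
      differentialAt E f (e.symm z) ((mfderiv 𝓘(ℝ, ℂ) 𝓘(ℝ, ℂ) e.symm z : ℂ →L[ℝ] ℂ) u) := by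
  rw [mfderiv_comp z (hf.smooth.mdifferentiableAt (by simp))
    (mfderiv_real_eq (mdifferentiableAt_chart_symm he hz)).mdifferentiableAt]
  rfl

include hf he he' in
theorem mfderiv_chart_symm_fderiv_coordMap {z : ℂ} (hz : z ∈ coordDomain f e e') (u : ℂ) :
    (mfderiv 𝓘(ℝ, E) 𝓘(ℝ, E) e'.symm (coordMap f e e' z) : E →L[ℝ] E)
      (fderiv ℝ (coordMap f e e') z u) =
    (mfderiv 𝓘(ℝ, ℂ) 𝓘(ℝ, E) (f ∘ e.symm) z : ℂ →L[ℝ] E) u := by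
  have h1 : f ∘ e.symm =ᶠ[𝓝 z] e'.symm ∘ coordMap f e e' := by
    filter_upwards [(isOpen_coordDomain hf he).mem_nhds hz] with w hw
    exact (e'.left_inv hw.2).symm
  have h2 : MDifferentiableAt 𝓘(ℝ, ℂ) 𝓘(ℝ, E) (coordMap f e e') z :=
    (((contDiffOn_coordMap hf he he').contDiffAt
      ((isOpen_coordDomain hf he).mem_nhds hz)).differentiableAt (by simp)).mdifferentiableAt
  have h3 : (mfderiv 𝓘(ℝ, ℂ) 𝓘(ℝ, E) (f ∘ e.symm) z : ℂ →L[ℝ] E) =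
    mfderiv 𝓘(ℝ, ℂ) 𝓘(ℝ, E) (e'.symm ∘ coordMap f e e') z := h1.mfderiv_eq
  have h4 : (mfderiv 𝓘(ℝ, ℂ) 𝓘(ℝ, E) (coordMap f e e') z : ℂ →L[ℝ] E) =
    fderiv ℝ (coordMap f e e') z := mfderiv_eq_fderiv
  rw [h3, mfderiv_comp z
    (mfderiv_real_eq (mdifferentiableAt_chart_symm he' (mapsTo_coordMap hz))).mdifferentiableAt h2,
    ← h4]
  rfl

omit [ChartedSpace ℂ S] [IsManifold 𝓘(ℂ, ℂ) ω S] in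
theorem innerAt_eq_coord {z : ℂ} (hz : z ∈ coordDomain f e e') (v w : E) :
    pullbackMetric g e'.symm (coordMap f e e' z) v w =
      innerAt g (f (e.symm z))
        ((mfderiv 𝓘(ℝ, E) 𝓘(ℝ, E) e'.symm (coordMap f e e' z) : E →L[ℝ] E) v)
        ((mfderiv 𝓘(ℝ, E) 𝓘(ℝ, E) e'.symm (coordMap f e e' z) : E →L[ℝ] E) w) := by
  have h1 : e'.symm (coordMap f e e' z) = f (e.symm z) := e'.left_inv hz.2
  change innerAt g (e'.symm (coordMap f e e' z)) _ _ = _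
  rw [h1]
  rfl

/-- The derivative of a chart rescales both the metric and the Kähler form by `|k|²`. -/
theorem exists_scale_factors (hf : IsConformalImmersion g f) (he : e ∈ atlas ℂ S)
    (he' : e' ∈ atlas E M) {z : ℂ} (hz : z ∈ coordDomain f e e') :
    ∃ r : ℝ, 0 < r ∧
      confFactor (pullbackMetric g e'.symm) (coordMap f e e') z =
        r * innerAt g (f (e.symm z)) (differentialAt E f (e.symm z) 1)
          (differentialAt E f (e.symm z) 1) ∧
      kahlerFactor (pullbackMetric g e'.symm) (coordMap f e e') z =
        r * innerAt g (f (e.symm z)) (mulI E (differentialAt E f (e.symm z) 1))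
          (differentialAt E f (e.symm z) Complex.I) := by
  obtain ⟨k, hk, hkm⟩ := exists_mfderiv_chart_symm he hz.1
  have hd (u : ℂ) : (mfderiv 𝓘(ℝ, E) 𝓘(ℝ, E) e'.symm (coordMap f e e' z) : E →L[ℝ] E)
      (fderiv ℝ (coordMap f e e') z u) = differentialAt E f (e.symm z) (k * u) := by
    rw [mfderiv_chart_symm_fderiv_coordMap hf he he' hz, mfderiv_comp_chart_symm hf he hz.1, hkm]
  refine ⟨k.re ^ 2 + k.im ^ 2, ?_, ?_, ?_⟩
  · have := Complex.normSq_pos.mpr hk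
    rw [Complex.normSq_apply] at this
    linarith
  · rw [confFactor, innerAt_eq_coord hz, hd, mul_one,
      conformal_apply (innerAt_symm g _) (differentialAt_conformal hf _), euclideanForm_apply]
    ring
  · rw [kahlerFactor, innerAt_eq_coord hz,
      mfderiv_mulI (mdifferentiableAt_chart_symm he' (mapsTo_coordMap hz)), hd, hd, mul_one,
      mul_comm k, kahlerForm_apply (innerAt_symm g _) (innerAt_mulI g _)]

include hf he he' in
theorem cosAngle_eq_coord {z : ℂ} (hz : z ∈ coordDomain f e e') :
    cosAngle g f (e.symm z) =
      kahlerFactor (pullbackMetric g e'.symm) (coordMap f e e') z /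
        confFactor (pullbackMetric g e'.symm) (coordMap f e e') z := by
  obtain ⟨r, hr, h1, h2⟩ := exists_scale_factors hf he he' hz
  rw [cosAngle_eq, h1, h2, mul_div_mul_left _ _ hr.ne']

include hf he he' in
theorem pullbackMetric_conformal {z : ℂ} (hz : z ∈ coordDomain f e e') :
    pullbackMetric g (f ∘ e.symm) z =
      confFactor (pullbackMetric g e'.symm) (coordMap f e e') z • euclideanForm := by
  obtain ⟨k, hk, hkm⟩ := exists_mfderiv_chart_symm he hz.1
  have h1 (u v : ℂ) : pullbackMetric g (f ∘ e.symm) z u v =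
      innerAt g (f (e.symm z)) (differentialAt E f (e.symm z) (k * u))
        (differentialAt E f (e.symm z) (k * v)) := by
    rw [← hkm, ← hkm, ← mfderiv_comp_chart_symm hf he hz.1, ← mfderiv_comp_chart_symm hf he hz.1]
    rfl
  have h2 : confFactor (pullbackMetric g e'.symm) (coordMap f e e') z =
      pullbackMetric g (f ∘ e.symm) z 1 1 := (pullbackMetric_eq_coord hf he he' hz 1 1).symm
  ext u v
  rw [h2]
  simp only [smul_apply, smul_eq_mul]
  rw [h1, h1, conformal_apply (innerAt_symm g _) (differentialAt_conformal hf _) (k * u),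
    conformal_apply (innerAt_symm g _) (differentialAt_conformal hf _) (k * 1)]
  simp only [euclideanForm_apply, Complex.mul_re, Complex.mul_im, Complex.one_re, Complex.one_im]
  ring

include hf he he' in
theorem confFactor_coord_pos {z : ℂ} (hz : z ∈ coordDomain f e e') :
    0 < confFactor (pullbackMetric g e'.symm) (coordMap f e e') z := by
  obtain ⟨r, hr, h1, -⟩ := exists_scale_factors hf he he' hz
  rw [h1]
  exact mul_pos hr (innerAt_differentialAt_pos hf _)

theorem contDiffOn_confFactor_coord (hf : IsConformalImmersion g f) (he : e ∈ atlas ℂ S)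
    (he' : e' ∈ atlas E M) :
    ContDiffOn ℝ ∞ (confFactor (pullbackMetric g e'.symm) (coordMap f e e'))
      (coordDomain f e e') := by
  have h1 := (contDiffOn_pullbackMetric g e.open_target (contMDiffOn_comp_chart_symm hf he)).mono
    (inter_subset_left : coordDomain f e e' ⊆ e.target)
  refine ((h1.clm_apply (contDiffOn_const (c := (1 : ℂ)))).clm_apply
    (contDiffOn_const (c := (1 : ℂ)))).congr fun z hz => ?_
  exact (pullbackMetric_eq_coord hf he he' hz 1 1).symm

variable [FiniteDimensional ℝ E]

/-- In charts a Chern minimal conformal immersion satisfies the coordinate equation: with the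
orthonormal basis `λ^{-1/2}, λ^{-1/2} i` the Levi-Civita terms of the induced metric cancel. -/
theorem isChernMinimalPatch_coord (hf : IsConformalImmersion g f) (hmin : IsChernMinimal g f)
    (he : e ∈ atlas ℂ S) (he' : e' ∈ atlas E M) :
    IsChernMinimalPatch (pullbackMetric g e'.symm) e'.target (coordMap f e e')
      (coordDomain f e e') where
  metric := isHermitianOn_pullbackMetric g he'
  isOpen := isOpen_coordDomain hf he
  smooth := contDiffOn_coordMap hf he he'
  mapsTo := mapsTo_coordMap
  immersion z hz h0 := by
    have h1 := confFactor_coord_pos hf he he' hz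
    rw [confFactor, h0, map_zero] at h1
    exact lt_irrefl _ h1
  norm_eq z hz := by
    rw [← pullbackMetric_eq_coord hf he he' hz, ← pullbackMetric_eq_coord hf he he' hz,
      pullbackMetric_conformal hf he he' hz]
    simp [euclideanForm_apply]
  orth z hz := by
    rw [← pullbackMetric_eq_coord hf he he' hz, pullbackMetric_conformal hf he he' hz]
    simp [euclideanForm_apply]
  minimal z hz := by
    set G := pullbackMetric g e'.symm
    set F := coordMap f e e'
    set l := confFactor G F z
    have hl0 : 0 < l := confFactor_coord_pos hf he he' hz
    set r : ℝ := (√l)⁻¹ with hr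
    have hr0 : r ≠ 0 := inv_ne_zero (Real.sqrt_pos.mpr hl0).ne'
    have hrl : l * (r * r) = 1 := by
      rw [hr, ← mul_inv, Real.mul_self_sqrt hl0.le, mul_inv_cancel₀ hl0.ne']
    have hm := hmin e he e' he' z hz.1 hz.2 (r • (1 : ℂ)) (r • Complex.I)
    rw [pullbackMetric_conformal hf he he' hz] at hm
    have hm' := hm (by simpa [euclideanForm_apply] using hrl)
      (by simpa [euclideanForm_apply] using hrl) (by simp [euclideanForm_apply])
    have hlc := leviCivita_conformal (isOpen_coordDomain hf he)
      (fun y hy => confFactor_coord_pos hf he he' hy) (contDiffOn_confFactor_coord hf he he')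
      (fun y hy => pullbackMetric_conformal hf he he' hy) hz
    have hC (v : E) : chernForm G (F z) (r • v) (r • v) = (r * r) • chernForm G (F z) v v := by
      simp only [chernForm, ← map_smul, smul_comm (r * r) (1 / 2 : ℝ)]
      congr 2
      ext x
      simp
      ring
    have hFF (u : ℂ) : fderiv ℝ (fun z' => fderiv ℝ F z' (r • u)) z (r • u) =
        (r * r) • fderiv ℝ (fun z' => fderiv ℝ F z' u) z u := by
      have hd : DifferentiableAt ℝ (fun z' => fderiv ℝ F z' u) z :=
        ((((contDiffOn_coordMap hf he he').contDiffAt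
          ((isOpen_coordDomain hf he).mem_nhds hz)).fderiv_right (m := ∞) (by simp)).clm_apply
          contDiffAt_const).differentiableAt (by simp)
      simp only [map_smul]
      rw [fderiv_fun_const_smul hd, smul_apply, smul_smul]
    simp only [chernSecondFundamentalForm] at hm'
    rw [show (⇑e' ∘ f ∘ ⇑e.symm) = F from rfl, hFF, hFF, map_smul, map_smul, hC, hC, hlc, hlc]
      at hm'
    have hcan (c : ℂ) : c * r • Complex.I * r • Complex.I = -(c * r • (1 : ℂ) * r • (1 : ℂ)) := by
      simp only [Complex.real_smul]
      linear_combination (c * r * r) * Complex.I_mul_I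
    rw [hcan, map_neg, sub_neg_eq_add] at hm'
    refine (smul_eq_zero.mp (Eq.trans ?_ hm')).resolve_left (mul_ne_zero hr0 hr0)
    simp only [smul_add]
    abel

end SurfaceCharts

/-! ### The curvature formula and the maximum principle -/

theorem IsChernMinimalPatch.mono {G : E → E →L[ℝ] E →L[ℝ] ℝ} {U : Set E} {F : ℂ → E} {O O' : Set ℂ}
    (h : IsChernMinimalPatch G U F O) (hO' : IsOpen O') (hsub : O' ⊆ O) :
    IsChernMinimalPatch G U F O' where
  metric := h.metric
  isOpen := hO'
  smooth := h.smooth.mono hsub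
  mapsTo := h.mapsTo.mono_left hsub
  immersion z hz := h.immersion z (hsub hz)
  norm_eq z hz := h.norm_eq z (hsub hz)
  orth z hz := h.orth z (hsub hz)
  minimal z hz := h.minimal z (hsub hz)

section Global

variable {M : Type*} [TopologicalSpace M] [ChartedSpace E M] [IsManifold 𝓘(ℂ, E) ω M]
  {S : Type*} [TopologicalSpace S] [ChartedSpace ℂ S] [IsManifold 𝓘(ℂ, ℂ) ω S]
  {g : HermitianMetric E M} {f : S → M}

/-- The logarithm of `sin² α` in the chart `e`. -/
def logSinSq (g : HermitianMetric E M) (f : S → M) (e : OpenPartialHomeomorph S ℂ) (z : ℂ) : ℝ :=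
  Real.log (1 - cosAngle g f (e.symm z) ^ 2)

theorem continuous_cosAngle [FiniteDimensional ℝ E] (hf : IsConformalImmersion g f)
    (hmin : IsChernMinimal g f) : Continuous (cosAngle g f) := by
  rw [continuous_iff_continuousAt]
  intro x
  set e := chartAt ℂ x
  set e' := chartAt E (f x)
  have hea : e ∈ atlas ℂ S := chart_mem_atlas ℂ x
  have hea' : e' ∈ atlas E M := chart_mem_atlas E (f x)
  have hx : e.symm (e x) = x := e.left_inv (mem_chart_source ℂ x)
  have hz : e x ∈ coordDomain f e e' := by
    refine ⟨mem_chart_target ℂ x, ?_⟩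
    rw [mem_preimage, Function.comp_apply, hx]
    exact mem_chart_source E (f x)
  have hp := isChernMinimalPatch_coord hf hmin hea hea'
  have hc : ContinuousAt (fun z => kahlerFactor (pullbackMetric g e'.symm) (coordMap f e e') z /
      confFactor (pullbackMetric g e'.symm) (coordMap f e e') z) (e x) :=
    (hp.contDiffAt_kahlerFactor hz).continuousAt.div (hp.contDiffAt_confFactor hz).continuousAt
      (hp.confFactor_pos hz).ne'
  have he0 : ContinuousAt e x := e.continuousAt (mem_chart_source ℂ x)
  refine (ContinuousAt.comp (f := e) hc he0).congr ?_
  filter_upwards [he0.preimage_mem_nhds (hp.isOpen.mem_nhds hz),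
    e.open_source.mem_nhds (mem_chart_source ℂ x)] with w hw hw'
  rw [Function.comp_apply, ← cosAngle_eq_coord hf hea hea' hw, e.left_inv hw']

/-- The set of coordinates of real points in the charts at `x`. -/
def realDomain (g : HermitianMetric E M) (f : S → M) (x : S) : Set ℂ :=
  coordDomain f (chartAt ℂ x) (chartAt E (f x)) ∩
    {z | cosAngle g f ((chartAt ℂ x).symm z) ^ 2 < 1}

omit [NormedSpace ℂ E] [IsManifold 𝓘(ℂ, E) ω M] [IsManifold 𝓘(ℂ, ℂ) ω S] in
theorem mem_coordDomain_chartAt (f : S → M) (x : S) :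
    chartAt ℂ x x ∈ coordDomain f (chartAt ℂ x) (chartAt E (f x)) := by
  refine ⟨mem_chart_target ℂ x, ?_⟩
  rw [mem_preimage, Function.comp_apply, (chartAt ℂ x).left_inv (mem_chart_source ℂ x)]
  exact mem_chart_source E (f x)

theorem isOpen_realDomain [FiniteDimensional ℝ E] (hf : IsConformalImmersion g f)
    (hmin : IsChernMinimal g f) (x : S) : IsOpen (realDomain g f x) := by
  have h1 : ContinuousOn (fun z => cosAngle g f ((chartAt ℂ x).symm z) ^ 2)
      (coordDomain f (chartAt ℂ x) (chartAt E (f x))) :=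
    ((continuous_cosAngle hf hmin).comp_continuousOn
      ((chartAt ℂ x).continuousOn_symm.mono inter_subset_left)).pow 2
  exact h1.isOpen_inter_preimage (isOpen_coordDomain hf (chart_mem_atlas ℂ x)) isOpen_Iio

omit [IsManifold 𝓘(ℂ, ℂ) ω S] in
theorem mem_realDomain (hf : IsConformalImmersion g f) {x : S} (hx : IsRealPoint E f x) :
    chartAt ℂ x x ∈ realDomain g f x := by
  refine ⟨mem_coordDomain_chartAt f x, ?_⟩
  rw [mem_ofPred_eq, (chartAt ℂ x).left_inv (mem_chart_source ℂ x)]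
  exact (isRealPoint_iff hf x).mp hx

section Patch

variable [FiniteDimensional ℝ E] (hf : IsConformalImmersion g f) (hmin : IsChernMinimal g f)
  (x : S)
include hf hmin

theorem isChernMinimalPatch_realDomain :
    IsChernMinimalPatch (pullbackMetric g (chartAt E (f x)).symm) (chartAt E (f x)).target
      (coordMap f (chartAt ℂ x) (chartAt E (f x))) (realDomain g f x) :=
  (isChernMinimalPatch_coord hf hmin (chart_mem_atlas ℂ x) (chart_mem_atlas E (f x))).mono
    (isOpen_realDomain hf hmin x) inter_subset_left

theorem one_sub_cosAngle_sq {z : ℂ} (hz : z ∈ realDomain g f x) :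
    1 - cosAngle g f ((chartAt ℂ x).symm z) ^ 2 =
      realFactor (pullbackMetric g (chartAt E (f x)).symm)
        (coordMap f (chartAt ℂ x) (chartAt E (f x))) z /
      confFactor (pullbackMetric g (chartAt E (f x)).symm)
        (coordMap f (chartAt ℂ x) (chartAt E (f x))) z ^ 2 := by
  have h1 := ((isChernMinimalPatch_realDomain hf hmin x).confFactor_pos hz).ne'
  rw [cosAngle_eq_coord hf (chart_mem_atlas ℂ x) (chart_mem_atlas E (f x)) hz.1, realFactor]
  field_simp

theorem realFactor_ne_zero {z : ℂ} (hz : z ∈ realDomain g f x) :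
    realFactor (pullbackMetric g (chartAt E (f x)).symm)
      (coordMap f (chartAt ℂ x) (chartAt E (f x))) z ≠ 0 := by
  intro h0
  have h1 := one_sub_cosAngle_sq hf hmin x hz
  rw [h0, zero_div] at h1
  have h2 : cosAngle g f ((chartAt ℂ x).symm z) ^ 2 < 1 := hz.2
  linarith

theorem logSinSq_eq {z : ℂ} (hz : z ∈ realDomain g f x) :
    logSinSq g f (chartAt ℂ x) z =
      -(Real.log (confFactor (pullbackMetric g (chartAt E (f x)).symm)
        (coordMap f (chartAt ℂ x) (chartAt E (f x))) z) +
      IsChernMinimalPatch.logFactor (pullbackMetric g (chartAt E (f x)).symm)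
        (coordMap f (chartAt ℂ x) (chartAt E (f x))) z) := by
  have h1 := ((isChernMinimalPatch_realDomain hf hmin x).confFactor_pos hz).ne'
  rw [logSinSq, one_sub_cosAngle_sq hf hmin x hz,
    Real.log_div (realFactor_ne_zero hf hmin x hz) (pow_ne_zero 2 h1), Real.log_pow,
    IsChernMinimalPatch.logFactor]
  push_cast
  ring

theorem contDiffAt_logSinSq {z : ℂ} (hz : z ∈ realDomain g f x) :
    ContDiffAt ℝ 2 (logSinSq g f (chartAt ℂ x)) z := by
  have hp := isChernMinimalPatch_realDomain hf hmin x
  have h1 := ((hp.contDiffAt_confFactor hz).log (hp.confFactor_pos hz).ne').add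
    (hp.contDiffAt_logFactor (fun z hz => realFactor_ne_zero hf hmin x hz) hz)
  refine (h1.neg.of_le ENat.LEInfty.out).congr_of_eventuallyEq ?_
  filter_upwards [hp.isOpen.mem_nhds hz] with w hw using logSinSq_eq hf hmin x hw

/-- At a real point `K + K^⊥ = Δ log sin² α / 2`, where `Δ = λ⁻¹ (∂_x² + ∂_y²)` is the Laplacian of
the induced metric. Of the conformal factor `λ` only the positivity matters. -/
theorem gaussCurvature_add_normalCurvature (hE : Module.finrank ℝ E = 4) (hx : IsRealPoint E f x) :
    ∃ l : ℝ, 0 < l ∧ gaussCurvature g f x + normalCurvature g f x =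
      Laplacian.laplacian (logSinSq g f (chartAt ℂ x)) (chartAt ℂ x x) / (2 * l) := by
  have hp := isChernMinimalPatch_realDomain hf hmin x
  have hr := fun z hz => realFactor_ne_zero hf hmin x (z := z) hz
  have hz := mem_realDomain hf hx
  have hl := hp.confFactor_pos hz
  refine ⟨_, hl, ?_⟩
  have hK := sectionalCurvature_conformal hp.isOpen (fun y hy => hp.confFactor_pos hy)
    (fun y hy => (hp.contDiffAt_confFactor hy).contDiffWithinAt)
    (fun y hy => pullbackMetric_conformal hf (chart_mem_atlas ℂ x) (chart_mem_atlas E (f x)) hy.1)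
    hz
  have hN := hp.normalBundleCurvature_pairing hr hE hz
    (Classical.epsilon_spec (hp.exists_isOrientedNormalFrame hr hz))
  have hK' : gaussCurvature g f x = _ := hK
  have hN' : normalCurvature g f x = _ := congrArg (fun t => t /
    confFactor (pullbackMetric g (chartAt E (f x)).symm)
        (coordMap f (chartAt ℂ x) (chartAt E (f x))) (chartAt ℂ x x)) hN
  set G := pullbackMetric g (chartAt E (f x)).symm
  set F := coordMap f (chartAt ℂ x) (chartAt E (f x))
  set P : ℂ → ℝ := fun z => Real.log (confFactor G F z)
  set Q : ℂ → ℝ := IsChernMinimalPatch.logFactor G F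
  have hlog : logSinSq g f (chartAt ℂ x) =ᶠ[𝓝 (chartAt ℂ x x)] -(P + Q) := by
    filter_upwards [hp.isOpen.mem_nhds hz] with w hw using logSinSq_eq hf hmin x hw
  have h1 : ContDiffAt ℝ 2 P (chartAt ℂ x x) :=
    ((hp.contDiffAt_confFactor hz).log hl.ne').of_le ENat.LEInfty.out
  have h2 : ContDiffAt ℝ 2 Q (chartAt ℂ x x) :=
    (hp.contDiffAt_logFactor hr hz).of_le ENat.LEInfty.out
  rw [(InnerProductSpace.laplacian_congr_nhds hlog).eq_of_nhds, InnerProductSpace.laplacian_neg,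
    Pi.neg_apply, h1.laplacian_add h2, hK', hN']
  field_simp
  ring

/-- The expressions of `log sin² α` in different charts differ by a holomorphic coordinate change,
so that the vanishing of their Laplacians is independent of the chart. -/
theorem harmonicAt_logSinSq (hE : Module.finrank ℝ E = 4) (hx : IsRealPoint E f x)
    (h0 : ∀ y, gaussCurvature g f y + normalCurvature g f y = 0) :
    InnerProductSpace.HarmonicAt (logSinSq g f (chartAt ℂ x)) (chartAt ℂ x x) := by
  refine ⟨contDiffAt_logSinSq hf hmin x (mem_realDomain hf hx), ?_⟩
  filter_upwards [(isOpen_realDomain hf hmin x).mem_nhds (mem_realDomain hf hx)] with z hz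
  set e := chartAt ℂ x
  set y := e.symm z
  set e₁ := chartAt ℂ y
  have hyr : IsRealPoint E f y := (isRealPoint_iff hf y).mpr hz.2
  have hsrc : y ∈ e₁.source := mem_chart_source ℂ y
  have hez : z ∈ e.target := hz.1.1
  obtain ⟨l, hl, hcurv⟩ := gaussCurvature_add_normalCurvature hf hmin y hE hyr
  rw [h0 y, eq_comm, div_eq_zero_iff, or_iff_left (by positivity)] at hcurv
  have hmem : z ∈ (e.symm.trans e₁).source := by
    rw [OpenPartialHomeomorph.trans_source]
    exact ⟨hez, hsrc⟩
  have hφ : AnalyticAt ℂ (e₁ ∘ e.symm) z := by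
    have h1 := (contDiffGroupoid ω 𝓘(ℂ, ℂ)).compatible (chart_mem_atlas ℂ x) (chart_mem_atlas ℂ y)
    have h2 := (mem_groupoid_of_pregroupoid.mp h1).1
    simp only [contDiffPregroupoid] at h2
    have h3 : ContDiffOn ℂ ω (e₁ ∘ e.symm) (e.symm.trans e₁).source := by
      simpa using! h2
    exact (h3.contDiffAt ((e.symm.trans e₁).open_source.mem_nhds hmem)).analyticAt
  have hcomp : logSinSq g f e =ᶠ[𝓝 z] logSinSq g f e₁ ∘ (e₁ ∘ e.symm) := by
    filter_upwards [(e.symm.trans e₁).open_source.mem_nhds hmem] with w hw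
    rw [OpenPartialHomeomorph.trans_source] at hw
    have : e₁.symm (e₁ (e.symm w)) = e.symm w := e₁.left_inv hw.2
    simp only [logSinSq, Function.comp_apply, this]
  rw [(InnerProductSpace.laplacian_congr_nhds hcomp).eq_of_nhds, Pi.zero_apply]
  exact laplacian_comp_eq_zero hφ
    (contDiffAt_logSinSq hf hmin y (mem_realDomain hf hyr)) hcurv

/-- If the Kähler angle is constant and all points are real, then `log sin² α` is constant. -/
theorem gaussCurvature_add_normalCurvature_eq_zero (hE : Module.finrank ℝ E = 4)
    (hreal : ∀ y, IsRealPoint E f y) {c : ℝ} (hc : ∀ y, kahlerAngle g f y = c) :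
    gaussCurvature g f x + normalCurvature g f x = 0 := by
  obtain ⟨l, -, hcurv⟩ := gaussCurvature_add_normalCurvature hf hmin x hE (hreal x)
  have h1 (y : S) : cosAngle g f y = Real.cos c := by
    have h2 := abs_le.mp (abs_cosAngle_le_one hf y)
    rw [← hc y, kahlerAngle_eq, Real.cos_arccos h2.1 h2.2]
  have h3 : logSinSq g f (chartAt ℂ x) = fun _ => Real.log (1 - Real.cos c ^ 2) := by
    funext z
    rw [logSinSq, h1]
  rw [hcurv, h3, InnerProductSpace.laplacian_const, Pi.zero_apply, zero_div]

/-- Near a real point where `sin² α` is maximal, `sin² α` is constant. -/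
theorem eventually_cosAngle_sq_eq (hE : Module.finrank ℝ E = 4) (hx : IsRealPoint E f x)
    (h0 : ∀ y, gaussCurvature g f y + normalCurvature g f y = 0)
    (hmax : ∀ y, cosAngle g f x ^ 2 ≤ cosAngle g f y ^ 2) :
    ∀ᶠ y in 𝓝 x, cosAngle g f y ^ 2 = cosAngle g f x ^ 2 := by
  set e := chartAt ℂ x
  have hsrc : x ∈ e.source := mem_chart_source ℂ x
  have hxx : e.symm (e x) = x := e.left_inv hsrc
  have hD := (isOpen_realDomain hf hmin x).mem_nhds (mem_realDomain hf hx)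
  have hpos : ∀ z ∈ realDomain g f x, 0 < 1 - cosAngle g f (e.symm z) ^ 2 := fun z hz =>
    sub_pos.mpr hz.2
  have hx1 := (isRealPoint_iff hf x).mp hx
  have hloc : IsLocalMax (logSinSq g f e) (e x) := by
    -- On the real domain the argument of the logarithm is positive.
    filter_upwards [hD] with z hz
    rw [logSinSq, logSinSq, hxx]
    exact Real.log_le_log (hpos z hz) (sub_le_sub_left (hmax _) 1)
  have hev := eventually_eq_of_isLocalMax_harmonic (harmonicAt_logSinSq hf hmin x hE hx h0) hloc
  have he0 : ContinuousAt e x := e.continuousAt hsrc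
  filter_upwards [he0.eventually hev, he0.preimage_mem_nhds hD, e.open_source.mem_nhds hsrc]
    with y hy hyD hys
  rw [logSinSq, logSinSq, hxx, e.left_inv hys] at hy
  have h1 := hpos (e y) hyD
  rw [e.left_inv hys] at h1
  have := Real.log_injOn_pos (mem_Ioi.mpr h1) (mem_Ioi.mpr (sub_pos.mpr hx1)) hy
  linarith

end Patch

/-- A continuous function on a connected space with constant square is constant. -/
theorem eq_of_sq_eq {X : Type*} [TopologicalSpace X] [PreconnectedSpace X] {c : X → ℝ}
    (hc : Continuous c) {k : ℝ} (hk : ∀ x, c x ^ 2 = k) (x y : X) : c x = c y := by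
  by_cases h0 : c y = 0
  · have h1 := hk x
    rw [← hk y, h0, zero_pow two_ne_zero] at h1
    rw [h0, pow_eq_zero_iff two_ne_zero |>.mp h1]
  · rcases isPreconnected_univ.eq_or_eq_neg_of_sq_eq hc.continuousOn
      (continuousOn_const (c := c y)) (fun z _ => (hk z).trans (hk y).symm) (fun _ => h0)
      with h1 | h1
    · exact h1 (mem_univ x)
    · have h2 : c y = -c y := h1 (mem_univ y)
      exact absurd (by linarith) h0

/-- A generic surface has a real point: otherwise `cos α = ±1` everywhere, with constant sign. -/
theorem exists_isRealPoint [FiniteDimensional ℝ E] [ConnectedSpace S]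
    (hf : IsConformalImmersion g f) (hmin : IsChernMinimal g f) (hgen : IsGeneric E f) :
    ∃ x, IsRealPoint E f x := by
  by_contra! hno
  have h1 (x : S) : cosAngle g f x ^ 2 = 1 := by
    refine le_antisymm ?_ (not_lt.mp fun h => hno x ((isRealPoint_iff hf x).mpr h))
    exact (sq_le_one_iff_abs_le_one _).mpr (abs_cosAngle_le_one hf x)
  obtain ⟨x₀⟩ := (inferInstance : Nonempty S)
  have h2 := fun x => eq_of_sq_eq (continuous_cosAngle hf hmin) h1 x x₀
  rcases mul_self_eq_one_iff.mp ((sq _).symm.trans (h1 x₀)) with h3 | h3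
  · exact hgen.1 fun x => (isComplexPoint_iff hf x).mpr ((h2 x).trans h3)
  · exact hgen.2 fun x => (isAnticomplexPoint_iff hf x).mpr ((h2 x).trans h3)

/-- If `K + K^⊥ = 0`, the maximum of `sin² α`, which is positive, is attained on a clopen set. -/
theorem exists_cosAngle_sq_eq [FiniteDimensional ℝ E] [CompactSpace S] [ConnectedSpace S]
    (hE : Module.finrank ℝ E = 4) (hf : IsConformalImmersion g f) (hmin : IsChernMinimal g f)
    (hgen : IsGeneric E f) (h0 : ∀ y, gaussCurvature g f y + normalCurvature g f y = 0) :
    ∃ k < 1, ∀ x, cosAngle g f x ^ 2 = k := by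
  have hcont : Continuous fun x => cosAngle g f x ^ 2 := (continuous_cosAngle hf hmin).pow 2
  obtain ⟨x₁, hx₁⟩ := exists_isRealPoint hf hmin hgen
  obtain ⟨x₀, -, hx₀⟩ := isCompact_univ.exists_isMinOn univ_nonempty hcont.continuousOn
  have hmin₀ : ∀ y, cosAngle g f x₀ ^ 2 ≤ cosAngle g f y ^ 2 := fun y => hx₀ (mem_univ y)
  have hlt : cosAngle g f x₀ ^ 2 < 1 :=
    (hmin₀ x₁).trans_lt ((isRealPoint_iff hf x₁).mp hx₁)
  refine ⟨_, hlt, ?_⟩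
  have hclopen : IsClopen {x | cosAngle g f x ^ 2 = cosAngle g f x₀ ^ 2} := by
    refine ⟨isClosed_eq hcont continuous_const, isOpen_iff_mem_nhds.mpr fun x hx => ?_⟩
    have hx' : cosAngle g f x ^ 2 = cosAngle g f x₀ ^ 2 := hx
    have hr : IsRealPoint E f x := (isRealPoint_iff hf x).mpr (hx' ▸ hlt)
    filter_upwards [eventually_cosAngle_sq_eq hf hmin x hE hr h0 fun y => hx' ▸ hmin₀ y] with y hy
    exact hy.trans hx'
  have huniv := hclopen.eq_univ ⟨x₀, rfl⟩
  intro x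
  have hx : x ∈ {x | cosAngle g f x ^ 2 = cosAngle g f x₀ ^ 2} := by rw [huniv]; exact mem_univ x
  exact hx

end Global

end ChernSurface

end

open ChernSurface in
theorem theorem1p3
    {E : Type*} [NormedAddCommGroup E] [NormedSpace ℂ E] (hE : Module.finrank ℂ E = 2)
    {M : Type*} [TopologicalSpace M] [ChartedSpace E M] [IsManifold 𝓘(ℂ, E) ω M]
    (g : HermitianMetric E M)
    {S : Type*} [TopologicalSpace S] [T2Space S] [ChartedSpace ℂ S] [IsManifold 𝓘(ℂ, ℂ) ω S]
    [CompactSpace S] [ConnectedSpace S]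
    (f : S → M) (hf : IsConformalImmersion g f) (hmin : IsChernMinimal g f)
    (hgen : IsGeneric E f) :
    ((∀ x, IsRealPoint E f x) ∧ ∃ c : ℝ, ∀ x, kahlerAngle g f x = c) ↔
      ∀ x, gaussCurvature g f x + normalCurvature g f x = 0 := by
  have hfin : FiniteDimensional ℂ E := Module.finite_of_finrank_pos (by omega)
  have : FiniteDimensional ℝ E := FiniteDimensional.complexToReal E
  have hE4 : Module.finrank ℝ E = 4 := by
    rw [finrank_real_of_complex, hE]
  constructor
  · rintro ⟨hreal, c, hc⟩ x
    exact gaussCurvature_add_normalCurvature_eq_zero hf hmin x hE4 hreal hc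
  · intro h0
    obtain ⟨k, hk, hc⟩ := exists_cosAngle_sq_eq hE4 hf hmin hgen h0
    obtain ⟨x₀⟩ := (inferInstance : Nonempty S)
    refine ⟨fun x => (isRealPoint_iff hf x).mpr (hc x ▸ hk), kahlerAngle g f x₀, fun x => ?_⟩
    rw [kahlerAngle_eq, kahlerAngle_eq, eq_of_sq_eq (continuous_cosAngle hf hmin) hc x x₀]
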